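/- Let $T>0$. There is a constant $C>0$, depending only on $T$, such that the following holds. Let $\rho_0,u_0\in L^2(0,1)$, let $p\in \dot L^2(0,T)=\{p\in L^2(0,T):\int_0^T p\,dt=0\}$, and let $(\rho,u)\in L^2(0,T;L^2(0,1))^2$ be the solution, in the sense of transposition, of \[ \begin{cases} \rho_t+\rho_x+u_x=0,\quad u_t-u_{xx}+u_x+\rho_x=0 & \text{in }(0,T)\times(0,1),\\ \rho(t,0)=\rho(t,1)+p(t),\quad u(t,0)=u(t,1)=0 & \text{for }t\in(0,T),\\ \rho(0,x)=\rho_0(x),\quad u(0,x)=u_0(x) & \text{for }x\in(0,1), \end{cases} \] that is, for all $f,g\in L^2(0,T;L^2(0,1))$, \[ \int_0^T\!\!\int_0^1(\rho f+ug)\,dx\,dt=\int_0^1\big(\rho_0(x)\sigma(0,x)+u_0(x)v(0,x)\big)\,dx+\int_0^T\sigma(t,1)\,p(t)\,dt, \] where $(\sigma,v)\in C([0,T];L^2(0,1))\times\big[C([0,T];L^2(0,1))\cap L^2(0,T;H^1_0(0,1))\big]$ is the weak solution of $-\sigma_t-\sigma_x-v_x=f$, $-v_t-v_{xx}-v_x-\sigma_x=g$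 in $(0,T)\times(0,1)$ with $\sigma(t,0)=\sigma(t,1)$, $v(t,0)=v(t,1)=0$ and $\sigma(T,\cdot)=v(T,\cdot)=0$. Then $\rho$ has a trace $\rho(\cdot,1)\in L^2(0,T)$ at $x=1$, and \[ \int_0^T\rho(t,1)^2\,dt\le C\left(\int_0^1\rho_0^2\,dx+\int_0^1u_0^2\,dx+\int_0^Tp^2\,dt\right). \] Here, for $w\in L^2((0,T)\times(0,1))$, the trace $w(\cdot,1)$ is the function $\theta\in L^2(0,T)$ with $\lim_{\varepsilon\to0^+}\frac1\varepsilon\int_{1-\varepsilon}^1\int_0^T|w(t,x)-\theta(t)|^2\,dt\,dx=0$. -/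

import Mathlib

open MeasureTheory Set Filter Topology

/-- `a ∈ L²(0,1)`. -/
def MemL2Space (a : ℝ → ℝ) : Prop :=
  MemLp a 2 (volume.restrict (Ioo (0 : ℝ) 1))

/-- `a ∈ L²(0,T)`. -/
def MemL2Time (T : ℝ) (a : ℝ → ℝ) : Prop :=
  MemLp a 2 (volume.restrict (Ioo (0 : ℝ) T))

/-- `p` belongs to the space of mean-zero functions in `L²(0,T)`. -/
def MemDotL2Time (T : ℝ) (p : ℝ → ℝ) : Prop :=
  MemL2Time T p ∧ ∫ t in (0 : ℝ)..T, p t = 0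

/-- `w ∈ L²(0,T; L²(0,1)) = L²((0,T) × (0,1))`; the first argument is time, the second is space. -/
def MemL2Q (T : ℝ) (w : ℝ → ℝ → ℝ) : Prop :=
  MemLp (Function.uncurry w) 2 (volume.restrict (Ioo (0 : ℝ) T ×ˢ Ioo (0 : ℝ) 1))

/-- `w ∈ C([0,T]; L²(0,1))`. -/
def MemCL2 (T : ℝ) (w : ℝ → ℝ → ℝ) : Prop :=
  (∀ t ∈ Icc (0 : ℝ) T, MemL2Space (w t)) ∧
  ∀ t ∈ Icc (0 : ℝ) T,
    Tendsto (fun s => eLpNorm (fun x => w s x - w t x) 2 (volume.restrict (Ioo (0 : ℝ) 1)))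
      (𝓝[Icc (0 : ℝ) T] t) (𝓝 0)

/-- `w ∈ L²(0,T; H¹₀(0,1))`. In one dimension the elements of `H¹₀(0,1)` are exactly the
primitives `x ↦ ∫₀ˣ d` of functions `d ∈ L²(0,1)` with `∫₀¹ d = 0`; here `d = wₓ`. -/
def MemL2H10 (T : ℝ) (w : ℝ → ℝ → ℝ) : Prop :=
  MemL2Q T w ∧ ∃ d : ℝ → ℝ → ℝ, MemL2Q T d ∧
    ∀ᵐ t ∂(volume.restrict (Ioo (0 : ℝ) T)),
      (∀ᵐ x ∂(volume.restrict (Ioo (0 : ℝ) 1)), w t x = ∫ y in (0 : ℝ)..x, d t y) ∧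
      ∫ y in (0 : ℝ)..1, d t y = 0

/-- `θ ∈ L²(0,T)` is the trace `w(·,1)` of `w ∈ L²((0,T) × (0,1))` on the side `x = 1`:
the mean over `x ∈ (1 - ε, 1)` of `‖w(·,x) - θ‖²` (norm of `L²(0,T)`) tends to `0` as `ε → 0⁺`.
It determines `θ` up to a null set and does not depend on the representative of `w`. -/
structure HasTraceAtOne (T : ℝ) (w : ℝ → ℝ → ℝ) (θ : ℝ → ℝ) : Prop where
  memL2Q : MemL2Q T w
  memL2Time : MemL2Time T θ
  tendsto : Tendsto
    (fun ε : ℝ => ε⁻¹ * ∫ x in (1 - ε)..1, ∫ t in (0 : ℝ)..T, (w t x - θ t) ^ 2)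
    (𝓝[>] 0) (𝓝 0)

/-- `(σ, v)` is the weak solution of the backward adjoint system
`-σₜ - σₓ - vₓ = f`, `-vₜ - vₓₓ - vₓ - σₓ = g` in `(0,T) × (0,1)`,
`σ(t,0) = σ(t,1)`, `v(t,0) = v(t,1) = 0`, `σ(T,·) = v(T,·) = 0`.
The test functions `(ξ, η)` run through a core of the operator
`A (ξ, η) = (-ξ' - η', -ξ' + η'' - η')` with the boundary conditions
`ξ(0) = ξ(1)`, `η(0) = η(1) = 0`, and `weak` is the equation
`-d/dt ⟨V, Φ⟩ = ⟨V, A Φ⟩ + ⟨F, Φ⟩`, `V(T) = 0`, integrated over `(t, T)`. -/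
structure IsAdjointSolution (T : ℝ) (f g σ v : ℝ → ℝ → ℝ) : Prop where
  memL2Q : MemL2Q T σ
  memL2H10 : MemL2H10 T v
  cont_fst : MemCL2 T σ
  cont_snd : MemCL2 T v
  weak : ∀ ξ η : ℝ → ℝ, ContDiff ℝ 2 ξ → ContDiff ℝ 2 η → ξ 0 = ξ 1 → η 0 = 0 → η 1 = 0 →
    ∀ t ∈ Icc (0 : ℝ) T,
      ∫ x in (0 : ℝ)..1, (σ t x * ξ x + v t x * η x) =
        ∫ s in t..T, ∫ x in (0 : ℝ)..1,
          (σ s x * (-deriv ξ x - deriv η x)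
            + v s x * (-deriv ξ x + deriv (deriv η) x - deriv η x)
            + f s x * ξ x + g s x * η x)

/-- `(ρ, u)` is the solution, in the sense of transposition, of
`ρₜ + ρₓ + uₓ = 0`, `uₜ - uₓₓ + uₓ + ρₓ = 0` in `(0,T) × (0,1)`,
`ρ(t,0) = ρ(t,1) + p(t)`, `u(t,0) = u(t,1) = 0`, `ρ(0,·) = ρ₀`, `u(0,·) = u₀`.
The function `τ` is the trace `σ(·,1)` of the first adjoint component. -/
structure IsTranspositionSolution (T : ℝ) (ρ₀ u₀ p : ℝ → ℝ) (ρ u : ℝ → ℝ → ℝ) : Prop where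
  memL2Q_fst : MemL2Q T ρ
  memL2Q_snd : MemL2Q T u
  identity : ∀ f g : ℝ → ℝ → ℝ, MemL2Q T f → MemL2Q T g →
    ∀ (σ v : ℝ → ℝ → ℝ) (τ : ℝ → ℝ), IsAdjointSolution T f g σ v → HasTraceAtOne T σ τ →
      (∫ t in (0 : ℝ)..T, ∫ x in (0 : ℝ)..1, ρ t x * f t x)
        + (∫ t in (0 : ℝ)..T, ∫ x in (0 : ℝ)..1, u t x * g t x) =
      (∫ x in (0 : ℝ)..1, (ρ₀ x * σ 0 x + u₀ x * v 0 x)) + ∫ t in (0 : ℝ)..T, τ t * p t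

/-! Write `A`, `B`, `P` for the squared `L²` norms of `ρ₀`, `u₀`, `p`, and `X`, `Θ` for those of
`uₓ` and of the trace `θ = ρ(·,1)` on `(0,T)`. The first equation is a periodic transport equation
for `ρ` with source `-uₓ`, the second a heat equation for `u`. Once `uₓ` is square integrable,
characteristics give the trace and `Θ ≤ c (A + P + X)`. Energy estimates bound `X` in turn, and the
trace enters them only through `∫ θ p`, which Young's inequality absorbs.

Adjoint solutions with `v = 0` turn the transposition identity into the weak transport equation
(`IsTranspositionSolution.transport_weak`). Those with `σ = 0` and `v = b(t) sin(nπx)` give an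
ordinary differential equation for each sine coefficient of `u`
(`IsTranspositionSolution.heat_weak`). Multiplying it by the coefficient and summing over the modes
yields the weak derivative `d = uₓ` and, since `⟨uₓ, u⟩ = 0`, the inequality `X ≤ ⟨d, ρ⟩ + B/2`
(`IsTranspositionSolution.exists_weak_derivative`).

On the line `t - x = s` the transport equation says that `ρ` is a primitive of `-d`. Following the
turns around the circle gives the explicit candidate `charSolution`, and a duality argument with
explicit solutions of the backward problem identifies it with `ρ` (`ae_eq_charSolution`). Its value
at `x = 1` is `outflow`, which is the trace (`hasTraceAtOne_outflow`) and obeys the bound on `Θ`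
(`integral_sq_outflow_le`).

Multiplying the transport equation by `ρ` along characteristics gives `⟨d, ρ⟩ ≤ A/2 + ∫ θ p + P/2`
(`neg_le_integral_charSolution_mul_source`): in the difference of squares at the two ends, `∫ θ²`
cancels. The three estimates together bound `X`, hence `Θ`. -/

/-! ### Primitives of integrable functions; completeness of the sines. -/

/-- Integration by parts for two primitives of integrable functions. -/
lemma integral_primitive_mul_add {a b c₁ c₂ : ℝ} {f g : ℝ → ℝ}
    (hf : IntervalIntegrable f volume a b) (hg : IntervalIntegrable g volume a b) :
    ∫ x in a..b, (f x * (c₂ + ∫ y in a..x, g y) + (c₁ + ∫ y in a..x, f y) * g x) =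
      (c₁ + ∫ y in a..b, f y) * (c₂ + ∫ y in a..b, g y) - c₁ * c₂ := by
  have key : ∀ {h : ℝ → ℝ} (c : ℝ), IntervalIntegrable h volume a b →
      AbsolutelyContinuousOnInterval (fun x => c + ∫ y in a..x, h y) a b := by
    intro h c hh
    have h1 := hh.absolutelyContinuousOnInterval_intervalIntegral (c := a) (by simp)
    have h2 : AbsolutelyContinuousOnInterval (fun _ : ℝ => c) a b :=
      ((LipschitzWith.const c).lipschitzOnWith (s := uIcc a b)).absolutelyContinuousOnInterval
    exact h2.fun_add h1
  have main := (key c₁ hf).integral_deriv_mul_eq_sub (key c₂ hg)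
  simp only [intervalIntegral.integral_same, add_zero] at main
  rw [← main]
  apply intervalIntegral.integral_congr_ae
  filter_upwards [hf.ae_hasDerivAt_integral, hg.ae_hasDerivAt_integral] with x h1 h2 hx
  have hx' : x ∈ uIcc a b := uIoc_subset_uIcc hx
  rw [((h1 hx' a (by simp)).const_add c₁).deriv, ((h2 hx' a (by simp)).const_add c₂).deriv]

lemma integral_primitive_mul_self {a b c : ℝ} {f : ℝ → ℝ}
    (hf : IntervalIntegrable f volume a b) :
    ∫ x in a..b, (c + ∫ y in a..x, f y) * f x = ((c + ∫ y in a..b, f y) ^ 2 - c ^ 2) / 2 := by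
  have h := integral_primitive_mul_add (c₁ := c) (c₂ := c) hf hf
  have h2 : ∫ x in a..b, (f x * (c + ∫ y in a..x, f y) + (c + ∫ y in a..x, f y) * f x) =
      2 * ∫ x in a..b, (c + ∫ y in a..x, f y) * f x := by
    rw [← intervalIntegral.integral_const_mul]
    congr 1; ext x; ring
  rw [h2] at h
  linarith

/-- The identity `2 sin((n+1)y) cos y = sin((n+2)y) + sin(ny)` shows that multiplication by
`cos(πx)` preserves the span of the sines, so induction on the power suffices. -/
lemma sin_integral_zero_mul_cos_pow {w : ℝ → ℝ} (hw : IntegrableOn w (Ioo 0 1))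
    (h : ∀ n : ℕ, ∫ x in Ioo (0 : ℝ) 1, w x * Real.sin (n * Real.pi * x) = 0) (j : ℕ) :
    ∀ n : ℕ, ∫ x in Ioo (0 : ℝ) 1,
      w x * (Real.sin (n * Real.pi * x) * Real.cos (Real.pi * x) ^ j) = 0 := by
  have int : ∀ (n j : ℕ), IntegrableOn
      (fun x => w x * (Real.sin (n * Real.pi * x) * Real.cos (Real.pi * x) ^ j)) (Ioo 0 1) := by
    intro n j
    refine Integrable.mul_bdd (c := 1) hw (by fun_prop) (ae_of_all _ fun x => ?_)
    rw [norm_mul, norm_pow, Real.norm_eq_abs, Real.norm_eq_abs]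
    exact mul_le_one₀ (Real.abs_sin_le_one _) (by positivity)
      (pow_le_one₀ (abs_nonneg _) (Real.abs_cos_le_one _))
  induction j with
  | zero => simpa using h
  | succ j ih =>
    intro n
    rcases n with _ | n
    · simp
    have e : ∀ x, w x * (Real.sin ((n + 1 : ℕ) * Real.pi * x) * Real.cos (Real.pi * x) ^ (j + 1)) =
        (1 / 2) * (w x * (Real.sin ((n + 2 : ℕ) * Real.pi * x) * Real.cos (Real.pi * x) ^ j)) +
        (1 / 2) * (w x * (Real.sin (n * Real.pi * x) * Real.cos (Real.pi * x) ^ j)) := by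
      intro x
      have e1 : ((n + 2 : ℕ) : ℝ) * Real.pi * x = (n + 1 : ℕ) * Real.pi * x + Real.pi * x := by
        push_cast; ring
      have e2 : (n : ℝ) * Real.pi * x = (n + 1 : ℕ) * Real.pi * x - Real.pi * x := by
        push_cast; ring
      rw [e1, e2, Real.sin_add, Real.sin_sub]
      ring
    simp_rw [e]
    rw [integral_add ((int _ _).const_mul _) ((int _ _).const_mul _), integral_const_mul,
      integral_const_mul, ih, ih]
    simp

/-- The functions `sin (nπx)` are complete in `L¹(0,1)`. -/
lemma ae_eq_zero_of_sin_integral_zero {w : ℝ → ℝ} (hw : IntegrableOn w (Ioo 0 1))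
    (h : ∀ n : ℕ, ∫ x in Ioo (0 : ℝ) 1, w x * Real.sin (n * Real.pi * x) = 0) :
    ∀ᵐ x ∂(volume.restrict (Ioo (0 : ℝ) 1)), w x = 0 := by
  -- The weighted function `m` is orthogonal to all polynomials in `cos(πx)`. These are dense in
  -- `C[0,1]` because `x ↦ cos(πx)` is a homeomorphism onto `[-1,1]`; hence `m = 0`, and the weight
  -- is positive inside the interval.
  set m : ℝ → ℝ := fun x => w x * Real.sin (Real.pi * x) with hm
  have hmi : IntegrableOn m (Ioo 0 1) := by
    refine Integrable.mul_bdd (c := 1) hw (by fun_prop) (ae_of_all _ fun x => ?_)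
    exact Real.abs_sin_le_one _
  have bddint : ∀ {f : ℝ → ℝ} {c : ℝ}, Continuous f → (∀ x ∈ Icc (0:ℝ) 1, |f x| ≤ c) →
      IntegrableOn (fun x => m x * f x) (Ioo 0 1) := by
    intro f c hf hc
    refine Integrable.mul_bdd (c := c) hmi hf.aestronglyMeasurable ?_
    filter_upwards [ae_restrict_mem measurableSet_Ioo] with x hx
    exact hc x (Ioo_subset_Icc_self hx)
  have cint : ∀ {f : ℝ → ℝ}, Continuous f → IntegrableOn (fun x => m x * f x) (Ioo 0 1) := by
    intro f hf
    obtain ⟨c, hc⟩ := isCompact_Icc.exists_bound_of_continuousOn (s := Icc (0:ℝ) 1) hf.continuousOn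
    exact bddint hf hc
  have poly : ∀ P : Polynomial ℝ,
      ∫ x in Ioo (0 : ℝ) 1, m x * P.eval (Real.cos (Real.pi * x)) = 0 := by
    intro P
    induction P using Polynomial.induction_on' with
    | add p q hp hq =>
      simp only [Polynomial.eval_add, mul_add]
      rw [integral_add (cint (by fun_prop)) (cint (by fun_prop)), hp, hq, add_zero]
    | monomial n a =>
      have := sin_integral_zero_mul_cos_pow hw h n 1
      simp only [Polynomial.eval_monomial]
      calc _ = ∫ x in Ioo (0 : ℝ) 1, a * (w x * (Real.sin ((1 : ℕ) * Real.pi * x)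
                * Real.cos (Real.pi * x) ^ n)) := by
              congr 1; ext x; simp [hm]; ring
        _ = 0 := by rw [integral_const_mul, this, mul_zero]
  have cont : ∀ f : ℝ → ℝ, Continuous f → ∫ x in Ioo (0 : ℝ) 1, m x * f x = 0 := by
    intro f hf
    set M := ∫ x in Ioo (0 : ℝ) 1, |m x| with hM
    have hM0 : 0 ≤ M := integral_nonneg fun _ => abs_nonneg _
    by_contra hne
    set I := ∫ x in Ioo (0 : ℝ) 1, m x * f x with hI
    have hIpos : 0 < |I| := abs_pos.mpr hne
    -- Weierstrass for `f` transported to `[-1,1]` by `arccos`. The denominator `M + 1` makes the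
    -- error strictly less than `|I|`, also when `M = 0`.
    obtain ⟨P, hP⟩ := exists_polynomial_near_of_continuousOn (-1) 1
      (fun y => f (Real.arccos y / Real.pi))
      (hf.comp (Real.continuous_arccos.div_const _)).continuousOn (|I| / (M + 1)) (by positivity)
    have near : ∀ x ∈ Ioo (0:ℝ) 1, |f x - P.eval (Real.cos (Real.pi * x))| ≤ |I| / (M + 1) := by
      intro x hx
      have := hP (Real.cos (Real.pi * x)) ⟨Real.neg_one_le_cos _, Real.cos_le_one _⟩
      rw [Real.arccos_cos (by have := Real.pi_pos; nlinarith [hx.1])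
        (by have := Real.pi_pos; nlinarith [hx.2]), mul_div_cancel_left₀ _ Real.pi_ne_zero] at this
      rw [abs_sub_comm]; exact this.le
    have e : I = ∫ x in Ioo (0 : ℝ) 1, m x * (f x - P.eval (Real.cos (Real.pi * x))) := by
      simp only [mul_sub]
      rw [integral_sub (cint hf) (cint (by fun_prop)), poly, sub_zero]
    have : |I| ≤ |I| / (M + 1) * M := by
      conv_lhs => rw [e]
      rw [hM, ← integral_const_mul, ← Real.norm_eq_abs]
      refine norm_integral_le_of_norm_le (hmi.abs.const_mul _) ?_
      filter_upwards [ae_restrict_mem measurableSet_Ioo] with x hx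
      rw [norm_mul, mul_comm]
      exact mul_le_mul_of_nonneg_right (near x hx) (abs_nonneg _)
    have h3 : |I| / (M + 1) * M < |I| := by
      rw [div_mul_eq_mul_div, div_lt_iff₀ (by positivity)]
      nlinarith
    linarith
  have mz : ∀ᵐ x, x ∈ Ioo (0:ℝ) 1 → m x = 0 := by
    refine isOpen_Ioo.ae_eq_zero_of_integral_contDiff_smul_eq_zero
      hmi.locallyIntegrableOn fun g hg _ hsupp => ?_
    rw [← cont g hg.continuous, ← setIntegral_eq_integral_of_forall_compl_eq_zero (s := Ioo 0 1)]
    · simp [mul_comm]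
    · intro x hx
      rw [image_eq_zero_of_notMem_tsupport (fun h => hx (hsupp h)), zero_smul]
  rw [ae_restrict_iff' measurableSet_Ioo]
  filter_upwards [mz] with x hx hx1
  have hs : 0 < Real.sin (Real.pi * x) :=
    Real.sin_pos_of_pos_of_lt_pi (by have := Real.pi_pos; nlinarith [hx1.1])
      (by have := Real.pi_pos; nlinarith [hx1.2])
  exact (mul_eq_zero.mp (hx hx1)).resolve_right hs.ne'

/-! ### Square integrable functions on the cylinder and traces at `x = 1`. -/

/-- Lebesgue measure on the space-time cylinder `(0,T) × (0,1)`, as a product measure. -/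
noncomputable abbrev cylMeasure (T : ℝ) : Measure (ℝ × ℝ) :=
  (volume.restrict (Ioo (0 : ℝ) T)).prod (volume.restrict (Ioo (0 : ℝ) 1))

lemma volume_restrict_cyl (T : ℝ) :
    volume.restrict (Ioo (0 : ℝ) T ×ˢ Ioo (0 : ℝ) 1) = cylMeasure T := by
  rw [cylMeasure, Measure.prod_restrict, Measure.volume_eq_prod]

lemma memL2Q_iff {T : ℝ} {w : ℝ → ℝ → ℝ} :
    MemL2Q T w ↔ MemLp (Function.uncurry w) 2 (cylMeasure T) := by
  rw [MemL2Q, volume_restrict_cyl]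

lemma ae_cyl_mem (T : ℝ) : ∀ᵐ z ∂(cylMeasure T), z ∈ Ioo (0 : ℝ) T ×ˢ Ioo (0 : ℝ) 1 := by
  rw [← volume_restrict_cyl]
  exact ae_restrict_mem (measurableSet_Ioo.prod measurableSet_Ioo)

lemma memL2Q_of_continuous {T : ℝ} {w : ℝ → ℝ → ℝ} (hw : Continuous (Function.uncurry w)) :
    MemL2Q T w := by
  rw [memL2Q_iff]
  obtain ⟨c, hc⟩ := ((isCompact_Icc (a := (0:ℝ)) (b := T)).prod
    (isCompact_Icc (a := (0:ℝ)) (b := 1))).exists_bound_of_continuousOn hw.continuousOn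
  refine MemLp.of_bound hw.aestronglyMeasurable c ?_
  filter_upwards [ae_cyl_mem T] with z hz
  exact hc z ⟨Ioo_subset_Icc_self hz.1, Ioo_subset_Icc_self hz.2⟩

lemma integral_cyl {T : ℝ} (hT : 0 ≤ T) {w : ℝ → ℝ → ℝ}
    (hw : Integrable (Function.uncurry w) (cylMeasure T)) :
    ∫ t in (0 : ℝ)..T, ∫ x in (0 : ℝ)..1, w t x = ∫ z, w z.1 z.2 ∂(cylMeasure T) := by
  rw [intervalIntegral.integral_of_le hT, integral_Ioc_eq_integral_Ioo]
  have : ∀ t, ∫ x in (0 : ℝ)..1, w t x = ∫ x in Ioo (0:ℝ) 1, w t x := fun t => by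
    rw [intervalIntegral.integral_of_le zero_le_one, integral_Ioc_eq_integral_Ioo]
  simp_rw [this]
  exact (integral_prod _ hw).symm

lemma memL2Space_of_continuous {a : ℝ → ℝ} (ha : Continuous a) : MemL2Space a := by
  obtain ⟨c, hc⟩ := (isCompact_Icc (a := (0:ℝ)) (b := 1)).exists_bound_of_continuousOn
    ha.continuousOn
  refine MemLp.of_bound ha.aestronglyMeasurable c ?_
  filter_upwards [ae_restrict_mem measurableSet_Ioo] with z hz
  exact hc z (Ioo_subset_Icc_self hz)

lemma memL2Time_of_continuous {T : ℝ} {a : ℝ → ℝ} (ha : Continuous a) : MemL2Time T a := by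
  obtain ⟨c, hc⟩ := (isCompact_Icc (a := (0:ℝ)) (b := T)).exists_bound_of_continuousOn
    ha.continuousOn
  refine MemLp.of_bound ha.aestronglyMeasurable c ?_
  filter_upwards [ae_restrict_mem measurableSet_Ioo] with z hz
  exact hc z (Ioo_subset_Icc_self hz)

lemma memCL2_of_continuous {T : ℝ} {w : ℝ → ℝ → ℝ} (hw : Continuous (Function.uncurry w)) :
    MemCL2 T w := by
  refine ⟨fun t _ => memL2Space_of_continuous (hw.uncurry_left t), fun t ht => ?_⟩
  have uc := ((isCompact_Icc (a := (0:ℝ)) (b := T)).prod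
    (isCompact_Icc (a := (0:ℝ)) (b := 1))).uniformContinuousOn_of_continuous hw.continuousOn
  rw [Metric.uniformContinuousOn_iff] at uc
  rw [ENNReal.tendsto_nhds_zero]
  intro ε hε
  obtain ⟨r, hr0, hr⟩ := ENNReal.lt_iff_exists_nnreal_btwn.mp hε
  obtain ⟨δ, hδ, H⟩ := uc r (by exact_mod_cast hr0)
  filter_upwards [self_mem_nhdsWithin, mem_nhdsWithin_of_mem_nhds (Metric.ball_mem_nhds t hδ)]
    with s hs hst
  refine (eLpNorm_le_of_ae_bound (C := r) ?_).trans ?_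
  · filter_upwards [ae_restrict_mem measurableSet_Ioo] with x hx
    have := H (s, x) ⟨hs, Ioo_subset_Icc_self hx⟩ (t, x) ⟨ht, Ioo_subset_Icc_self hx⟩
      (by simpa [Prod.dist_eq, hδ] using hst)
    exact this.le
  · simp only [Measure.restrict_apply_univ, Real.volume_Ioo, sub_zero, ENNReal.ofReal_one,
      ENNReal.one_rpow, one_mul, ENNReal.ofReal_coe_nnreal]
    exact hr.le

/-- A mean over `(1 - ε, 1)` is at most the supremum of the integrand, so a modulus at almost every
abscissa suffices. -/
lemma hasTraceAtOne_of_modulus {T : ℝ} {w : ℝ → ℝ → ℝ} {θ ω : ℝ → ℝ} (hT : 0 ≤ T)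
    (hw : MemL2Q T w) (hθ : MemL2Time T θ) (hω : Tendsto ω (𝓝[>] 0) (𝓝 0))
    (h : ∀ᵐ x, x ∈ Ioo (0 : ℝ) 1 → ∫ t in (0 : ℝ)..T, (w t x - θ t) ^ 2 ≤ ω (1 - x)) :
    HasTraceAtOne T w θ := by
  refine ⟨hw, hθ, ?_⟩
  rw [Metric.tendsto_nhds]
  intro e he
  have h1 : ∀ᶠ y in 𝓝[>] (0:ℝ), ω y < e / 2 := hω.eventually (gt_mem_nhds (by positivity))
  obtain ⟨δ, hδ, H⟩ := mem_nhdsGT_iff_exists_Ioo_subset.mp h1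
  filter_upwards [Ioo_mem_nhdsGT (show (0:ℝ) < min δ 1 from lt_min hδ one_pos)] with ε hε
  have hε1 : ε < δ := hε.2.trans_le (min_le_left _ _)
  have hε2 : ε < 1 := hε.2.trans_le (min_le_right _ _)
  have b : ‖∫ x in (1 - ε)..1, ∫ t in (0 : ℝ)..T, (w t x - θ t) ^ 2‖ ≤ e / 2 * |1 - (1 - ε)| := by
    refine intervalIntegral.norm_integral_le_of_norm_le_const_ae ?_
    filter_upwards [h, compl_mem_ae_iff.mpr (measure_singleton (1:ℝ))] with x hx hx1 hxI
    rw [uIoc_of_le (by linarith [hε.1])] at hxI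
    have hx1 : x < 1 := lt_of_le_of_ne hxI.2 hx1
    rw [Real.norm_of_nonneg (intervalIntegral.integral_nonneg hT fun _ _ => sq_nonneg _)]
    refine (hx ⟨by linarith [hxI.1], hx1⟩).trans ?_
    exact (H (show 1 - x ∈ Ioo 0 δ from ⟨by linarith, by linarith [hxI.1]⟩)).le
  rw [sub_sub_cancel, abs_of_pos hε.1] at b
  rw [dist_zero_right, norm_mul, norm_inv, Real.norm_of_nonneg hε.1.le]
  calc _ ≤ ε⁻¹ * (e / 2 * ε) := mul_le_mul_of_nonneg_left b (inv_nonneg.mpr hε.1.le)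
    _ = e / 2 := by field_simp [hε.1.ne']
    _ < e := by linarith

lemma hasTraceAtOne_of_continuous {T : ℝ} (hT : 0 ≤ T) {w : ℝ → ℝ → ℝ}
    (hw : Continuous (Function.uncurry w)) : HasTraceAtOne T w (fun t => w t 1) := by
  refine hasTraceAtOne_of_modulus hT (memL2Q_of_continuous hw)
    (memL2Time_of_continuous (hw.comp (by fun_prop : Continuous fun t : ℝ => (t, (1:ℝ)))))
    (ω := fun y => ∫ t in (0 : ℝ)..T, (w t (1 - y) - w t 1) ^ 2) ?_ (ae_of_all _ fun x _ => ?_)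
  · refine Tendsto.mono_left ?_ nhdsWithin_le_nhds
    have c : Continuous (fun y => ∫ t in (0 : ℝ)..T, (w t (1 - y) - w t 1) ^ 2) := by
      apply intervalIntegral.continuous_parametric_intervalIntegral_of_continuous'
      have h1 : Continuous fun q : ℝ × ℝ => w q.2 (1 - q.1) :=
        hw.comp (by fun_prop : Continuous fun q : ℝ × ℝ => (q.2, 1 - q.1))
      have h2 : Continuous fun q : ℝ × ℝ => w q.2 1 :=
        hw.comp (by fun_prop : Continuous fun q : ℝ × ℝ => (q.2, (1:ℝ)))
      exact (h1.sub h2).pow 2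
    simpa using c.tendsto 0
  · simp

/-! ### Two families of adjoint solutions and the weak equations they produce. -/

/-- A classical test function for the transport equation, with its partial derivatives:
periodic in space and vanishing at the final time. -/
structure IsTransportTest (T : ℝ) (σ σt σx : ℝ → ℝ → ℝ) : Prop where
  cont : Continuous (Function.uncurry σ)
  cont_t : Continuous (Function.uncurry σt)
  cont_x : Continuous (Function.uncurry σx)
  deriv_t : ∀ t x, HasDerivAt (fun s => σ s x) (σt t x) t
  deriv_x : ∀ t x, HasDerivAt (fun y => σ t y) (σx t x) x
  periodic : ∀ t ∈ Icc (0 : ℝ) T, σ t 0 = σ t 1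
  final : ∀ x ∈ Icc (0 : ℝ) 1, σ T x = 0

lemma memL2H10_zero (T : ℝ) : MemL2H10 T (fun _ _ => 0) :=
  ⟨memL2Q_of_continuous (by fun_prop), fun _ _ => 0, memL2Q_of_continuous (by fun_prop), by simp⟩

/-- Any `σ` becomes an adjoint solution with `v = 0` if the second source is taken to be `-σₓ`; the
heat equation then imposes nothing on `σ`. -/
lemma IsTransportTest.isAdjointSolution {T : ℝ} {σ σt σx : ℝ → ℝ → ℝ}
    (h : IsTransportTest T σ σt σx) :
    IsAdjointSolution T (fun t x => -σt t x - σx t x) (fun t x => -σx t x) σ (fun _ _ => 0) where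
  memL2Q := memL2Q_of_continuous h.cont
  memL2H10 := memL2H10_zero T
  cont_fst := memCL2_of_continuous h.cont
  cont_snd := memCL2_of_continuous (by fun_prop)
  weak := by
    intro ξ η hξ hη hξ01 hη0 hη1 t ht
    have dξ : ∀ x, HasDerivAt ξ (deriv ξ x) x := fun x =>
      (hξ.differentiable (by norm_num) x).hasDerivAt
    have dη : ∀ x, HasDerivAt η (deriv η x) x := fun x =>
      (hη.differentiable (by norm_num) x).hasDerivAt
    have cξ' : Continuous (deriv ξ) := hξ.continuous_deriv (by norm_num)
    have cη' : Continuous (deriv η) := hη.continuous_deriv (by norm_num)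
    have cξ := hξ.continuous
    have cη := hη.continuous
    have cs : ∀ s, Continuous (σ s) := fun s => h.cont.uncurry_left s
    have cst : ∀ s, Continuous (σt s) := fun s => h.cont_t.uncurry_left s
    have csx : ∀ s, Continuous (σx s) := fun s => h.cont_x.uncurry_left s
    have inner : ∀ s ∈ uIcc t T, (∫ x in (0 : ℝ)..1,
          (σ s x * (-deriv ξ x - deriv η x)
            + 0 * (-deriv ξ x + deriv (deriv η) x - deriv η x)
            + (-σt s x - σx s x) * ξ x + -σx s x * η x)) =
        -∫ x in (0 : ℝ)..1, σt s x * ξ x := by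
      intro s hs
      rw [uIcc_of_le ht.2] at hs
      have hs' : s ∈ Icc (0:ℝ) T := ⟨ht.1.trans hs.1, hs.2⟩
      -- All space derivatives combine into that of `σ (ξ + η)`, whose values at the two ends agree
      -- by periodicity of `σ` and `ξ` and the vanishing of `η`.
      have ftc : ∫ x in (0 : ℝ)..1, (σx s x * (ξ x + η x) + σ s x * (deriv ξ x + deriv η x)) =
          σ s 1 * (ξ 1 + η 1) - σ s 0 * (ξ 0 + η 0) := by
        refine intervalIntegral.integral_eq_sub_of_hasDerivAt
          (f := fun x => σ s x * (ξ x + η x)) (fun x _ => ?_) ?_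
        · exact (h.deriv_x s x).mul ((dξ x).add (dη x))
        · have := cs s; have := csx s
          exact Continuous.intervalIntegrable (by fun_prop) _ _
      rw [h.periodic s hs', hξ01, hη0, hη1, sub_self] at ftc
      have e : ∀ x, (σ s x * (-deriv ξ x - deriv η x)
            + 0 * (-deriv ξ x + deriv (deriv η) x - deriv η x)
            + (-σt s x - σx s x) * ξ x + -σx s x * η x) = -(σt s x * ξ x) -
            (σx s x * (ξ x + η x) + σ s x * (deriv ξ x + deriv η x)) := fun x => by ring
      simp_rw [e]
      have := cs s; have := csx s; have := cst s
      rw [intervalIntegral.integral_sub (Continuous.intervalIntegrable (by fun_prop) _ _)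
        (Continuous.intervalIntegrable (by fun_prop) _ _), ftc, sub_zero,
        intervalIntegral.integral_neg]
    rw [intervalIntegral.integral_congr inner, intervalIntegral.integral_neg]
    have cF : Continuous (Function.uncurry fun s x => σt s x * ξ x) :=
      h.cont_t.mul (cξ.comp continuous_snd)
    rw [intervalIntegral_intervalIntegral_swap]
    · have : ∀ x ∈ uIcc (0:ℝ) 1, ∫ s in t..T, σt s x * ξ x = -(σ t x * ξ x) := by
        intro x hx
        rw [uIcc_of_le zero_le_one] at hx
        rw [intervalIntegral.integral_mul_const,
          intervalIntegral.integral_eq_sub_of_hasDerivAt (fun s _ => h.deriv_t s x)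
            ((h.cont_t.comp (by fun_prop : Continuous fun s : ℝ => (s, x))).intervalIntegrable _ _),
          h.final x hx]
        ring
      rw [intervalIntegral.integral_congr this, intervalIntegral.integral_neg]
      simp
    · exact (cF.continuousOn.integrableOn_compact ((isCompact_uIcc (a := t) (b := T)).prod
        (isCompact_uIcc (a := (0:ℝ)) (b := 1)))).mono_set
        (prod_mono uIoc_subset_uIcc uIoc_subset_uIcc)

/-- Taking `σ = 0` leaves `f = -vₓ` and `g = -vₜ - vₓₓ - vₓ`. These separated solutions isolate one
sine coefficient of `u`. -/
lemma sineTest_isAdjointSolution {T : ℝ} {b b' : ℝ → ℝ} (n : ℕ) (hb' : Continuous b')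
    (hb : ∀ t, HasDerivAt b (b' t) t) (hbT : b T = 0) {l : ℝ} (hl : l = n * Real.pi) :
    IsAdjointSolution T (fun t x => -(b t * (l * Real.cos (l * x))))
      (fun t x => -(b' t * Real.sin (l * x)) + b t * (l ^ 2 * Real.sin (l * x))
        - b t * (l * Real.cos (l * x)))
      (fun _ _ => 0) (fun t x => b t * Real.sin (l * x)) := by
  have cb : Continuous b := continuous_iff_continuousAt.mpr fun t => (hb t).continuousAt
  have hs1 : Real.sin (l * 1) = 0 := by rw [mul_one, hl]; exact Real.sin_nat_mul_pi n
  have hs0 : Real.sin (l * 0) = 0 := by simp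
  have dsin : ∀ x, HasDerivAt (fun y => Real.sin (l * y)) (l * Real.cos (l * x)) x := fun x => by
    simpa [mul_comm] using ((hasDerivAt_id x).const_mul l).sin
  have dcos : ∀ x, HasDerivAt (fun y => Real.cos (l * y)) (-(l * Real.sin (l * x))) x := fun x => by
    simpa [mul_comm] using ((hasDerivAt_id x).const_mul l).cos
  have prim : ∀ t x, ∫ y in (0:ℝ)..x, b t * (l * Real.cos (l * y)) = b t * Real.sin (l * x) := by
    intro t x
    rw [intervalIntegral.integral_const_mul, intervalIntegral.integral_eq_sub_of_hasDerivAt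
      (fun y _ => dsin y) (Continuous.intervalIntegrable (by fun_prop) _ _), hs0, sub_zero]
  have cv : Continuous (Function.uncurry fun t x => b t * Real.sin (l * x)) := by
    simp only [Function.uncurry_def]; fun_prop
  refine ⟨memL2Q_of_continuous continuous_const, ⟨memL2Q_of_continuous cv,
    fun t x => b t * (l * Real.cos (l * x)), memL2Q_of_continuous ?_, ae_of_all _ fun t => ?_⟩,
    memCL2_of_continuous continuous_const, memCL2_of_continuous cv, ?_⟩
  · simp only [Function.uncurry_def]; fun_prop
  · simp only [prim, hs1, mul_zero, and_true, Filter.eventually_true]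
  intro ξ η hξ hη hξ01 hη0 hη1 t ht
  have dξ : ∀ x, HasDerivAt ξ (deriv ξ x) x := fun x =>
    (hξ.differentiable (by norm_num) x).hasDerivAt
  have dη : ∀ x, HasDerivAt η (deriv η x) x := fun x =>
    (hη.differentiable (by norm_num) x).hasDerivAt
  have hη' : ContDiff ℝ 1 (deriv η) := ContDiff.iterate_deriv' 1 1 hη
  have ddη : ∀ x, HasDerivAt (deriv η) (deriv (deriv η) x) x := fun x =>
    (hη'.differentiable (by norm_num) x).hasDerivAt
  have cξ' : Continuous (deriv ξ) := hξ.continuous_deriv (by norm_num)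
  have cη' : Continuous (deriv η) := hη'.continuous
  have cη'' : Continuous (deriv (deriv η)) := hη'.continuous_deriv (by norm_num)
  have cξ := hξ.continuous
  have cη := hη.continuous
  -- Apart from the term in `b'`, the integrand is `b` times an exact derivative of a function that
  -- vanishes at both ends, since `η` and the sine do.
  have ftc : ∫ x in (0 : ℝ)..1,
      (-(l * Real.cos (l * x) * ξ x + Real.sin (l * x) * deriv ξ x)
        + (l * Real.cos (l * x) * deriv η x + Real.sin (l * x) * deriv (deriv η) x)
        - (l * (-(l * Real.sin (l * x))) * η x + l * Real.cos (l * x) * deriv η x)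
        - (l * Real.cos (l * x) * η x + Real.sin (l * x) * deriv η x)) = 0 := by
    rw [intervalIntegral.integral_eq_sub_of_hasDerivAt
      (f := fun x => -(Real.sin (l * x) * ξ x) + Real.sin (l * x) * deriv η x
        - l * Real.cos (l * x) * η x - Real.sin (l * x) * η x) (fun x _ => ?_)
      (Continuous.intervalIntegrable (by fun_prop) _ _), hs1, hs0, hη0, hη1]
    · ring
    · exact (((((dsin x).mul (dξ x)).neg.add ((dsin x).mul (ddη x))).sub
        (((dcos x).const_mul l).mul (dη x))).sub ((dsin x).mul (dη x)))
  have inner : ∀ s, (∫ x in (0 : ℝ)..1,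
        (0 * (-deriv ξ x - deriv η x)
          + b s * Real.sin (l * x) * (-deriv ξ x + deriv (deriv η) x - deriv η x)
          + -(b s * (l * Real.cos (l * x))) * ξ x
          + (-(b' s * Real.sin (l * x)) + b s * (l ^ 2 * Real.sin (l * x))
        - b s * (l * Real.cos (l * x))) * η x)) =
      -(b' s * ∫ x in (0 : ℝ)..1, Real.sin (l * x) * η x) := by
    intro s
    have split : ∀ x, (0 * (-deriv ξ x - deriv η x)
          + b s * Real.sin (l * x) * (-deriv ξ x + deriv (deriv η) x - deriv η x)
          + -(b s * (l * Real.cos (l * x))) * ξ x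
          + (-(b' s * Real.sin (l * x)) + b s * (l ^ 2 * Real.sin (l * x))
        - b s * (l * Real.cos (l * x))) * η x) =
        b s * (-(l * Real.cos (l * x) * ξ x + Real.sin (l * x) * deriv ξ x)
        + (l * Real.cos (l * x) * deriv η x + Real.sin (l * x) * deriv (deriv η) x)
        - (l * (-(l * Real.sin (l * x))) * η x + l * Real.cos (l * x) * deriv η x)
        - (l * Real.cos (l * x) * η x + Real.sin (l * x) * deriv η x))
        - b' s * (Real.sin (l * x) * η x) := fun x => by ring
    simp_rw [split]
    rw [intervalIntegral.integral_sub (Continuous.intervalIntegrable (by fun_prop) _ _)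
      (Continuous.intervalIntegrable (by fun_prop) _ _), intervalIntegral.integral_const_mul, ftc,
      intervalIntegral.integral_const_mul, mul_zero, zero_sub]
  simp_rw [inner]
  rw [intervalIntegral.integral_neg, intervalIntegral.integral_mul_const,
    intervalIntegral.integral_eq_sub_of_hasDerivAt (fun s _ => hb s) (hb'.intervalIntegrable _ _),
    hbT]
  simp only [zero_mul, zero_add, zero_sub, neg_mul, neg_neg]
  rw [← intervalIntegral.integral_const_mul]
  congr 1; ext x; ring

lemma MemL2Q.integrable_mul_continuous {T : ℝ} {w φ : ℝ → ℝ → ℝ} (hw : MemL2Q T w)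
    (hφ : Continuous (Function.uncurry φ)) :
    Integrable (fun z : ℝ × ℝ => w z.1 z.2 * φ z.1 z.2) (cylMeasure T) :=
  (memL2Q_iff.mp hw).integrable_mul (memL2Q_iff.mp (memL2Q_of_continuous hφ))

lemma MemL2Q.iterated_integral_mul {T : ℝ} (hT : 0 ≤ T) {w φ : ℝ → ℝ → ℝ} (hw : MemL2Q T w)
    (hφ : Continuous (Function.uncurry φ)) :
    ∫ t in (0 : ℝ)..T, ∫ x in (0 : ℝ)..1, w t x * φ t x =
      ∫ z, w z.1 z.2 * φ z.1 z.2 ∂(cylMeasure T) :=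
  integral_cyl hT (w := fun t x => w t x * φ t x) (hw.integrable_mul_continuous hφ)

/-- This is `ρₜ + ρₓ = -uₓ` in weak form: with `v = 0` the datum `u₀` drops out, and the derivative
of `u` still rests on the test function. -/
lemma IsTranspositionSolution.transport_weak {T : ℝ} (hT : 0 ≤ T) {ρ₀ u₀ p : ℝ → ℝ}
    {ρ u : ℝ → ℝ → ℝ} (hs : IsTranspositionSolution T ρ₀ u₀ p ρ u) {σ σt σx : ℝ → ℝ → ℝ}
    (h : IsTransportTest T σ σt σx) :
    (∫ z, ρ z.1 z.2 * (σt z.1 z.2 + σx z.1 z.2) ∂(cylMeasure T))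
      + ∫ z, u z.1 z.2 * σx z.1 z.2 ∂(cylMeasure T) =
    -(∫ x in (0 : ℝ)..1, ρ₀ x * σ 0 x) - ∫ t in (0 : ℝ)..T, σ t 1 * p t := by
  have cf : Continuous (Function.uncurry fun t x => -σt t x - σx t x) :=
    h.cont_t.neg.sub h.cont_x
  have cg : Continuous (Function.uncurry fun t x => -σx t x) := h.cont_x.neg
  have id := hs.identity _ _ (memL2Q_of_continuous cf) (memL2Q_of_continuous cg) _ _ _
    h.isAdjointSolution (hasTraceAtOne_of_continuous hT h.cont)
  rw [hs.memL2Q_fst.iterated_integral_mul hT cf,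
    hs.memL2Q_snd.iterated_integral_mul hT cg] at id
  simp only [mul_zero, add_zero] at id
  have e1 : ∫ z, ρ z.1 z.2 * (-σt z.1 z.2 - σx z.1 z.2) ∂(cylMeasure T) =
      -∫ z, ρ z.1 z.2 * (σt z.1 z.2 + σx z.1 z.2) ∂(cylMeasure T) := by
    rw [← integral_neg]; congr 1; ext z; ring
  have e2 : ∫ z, u z.1 z.2 * -σx z.1 z.2 ∂(cylMeasure T) =
      -∫ z, u z.1 z.2 * σx z.1 z.2 ∂(cylMeasure T) := by
    rw [← integral_neg]; congr 1; ext z; ring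
  rw [e1, e2] at id
  linarith

/-- With `σ = 0` the data `ρ₀` and `p` drop out. The two first-order terms have the same cosine
factor and merge into `u + ρ`. -/
lemma IsTranspositionSolution.heat_weak {T : ℝ} (hT : 0 ≤ T) {ρ₀ u₀ p : ℝ → ℝ}
    {ρ u : ℝ → ℝ → ℝ} (hs : IsTranspositionSolution T ρ₀ u₀ p ρ u) {b b' : ℝ → ℝ} (n : ℕ)
    (hb' : Continuous b') (hb : ∀ t, HasDerivAt b (b' t) t) (hbT : b T = 0) {l : ℝ}
    (hl : l = n * Real.pi) :
    ∫ z, (u z.1 z.2 * (-(b' z.1 * Real.sin (l * z.2)) + l ^ 2 * (b z.1 * Real.sin (l * z.2)))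
      - l * ((u z.1 z.2 + ρ z.1 z.2) * (b z.1 * Real.cos (l * z.2)))) ∂(cylMeasure T) =
    b 0 * ∫ x in (0 : ℝ)..1, u₀ x * Real.sin (l * x) := by
  have cb : Continuous b := continuous_iff_continuousAt.mpr fun t => (hb t).continuousAt
  have cf : Continuous (Function.uncurry fun t x => -(b t * (l * Real.cos (l * x)))) := by
    simp only [Function.uncurry_def]; fun_prop
  have cg : Continuous (Function.uncurry fun t x => -(b' t * Real.sin (l * x))
      + b t * (l ^ 2 * Real.sin (l * x)) - b t * (l * Real.cos (l * x))) := by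
    simp only [Function.uncurry_def]; fun_prop
  have id := hs.identity _ _ (memL2Q_of_continuous cf) (memL2Q_of_continuous cg) _ _ _
    (sineTest_isAdjointSolution n hb' hb hbT hl)
    (hasTraceAtOne_of_continuous hT (w := fun _ _ => 0) (by fun_prop))
  rw [hs.memL2Q_fst.iterated_integral_mul hT cf,
    hs.memL2Q_snd.iterated_integral_mul hT cg, ← integral_add
      (hs.memL2Q_fst.integrable_mul_continuous cf)
      (hs.memL2Q_snd.integrable_mul_continuous cg)] at id
  simp only [mul_zero, zero_mul, zero_add, intervalIntegral.integral_zero, add_zero] at id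
  rw [← intervalIntegral.integral_const_mul]
  convert id using 1
  · congr 1; ext z; ring
  · congr 1; ext x; ring

/-! ### Orthogonal series and `L²` tools. -/

section Hilbert

variable {H : Type*} [NormedAddCommGroup H] [InnerProductSpace ℝ H]

lemma norm_sum_sq_of_orthogonal {D : ℕ → H} (orth : Pairwise fun i j => inner ℝ (D i) (D j) = 0)
    (s : Finset ℕ) : ‖∑ i ∈ s, D i‖ ^ 2 = ∑ i ∈ s, ‖D i‖ ^ 2 := by
  induction s using Finset.induction_on with
  | empty => simp
  | insert a s ha ih =>
    rw [Finset.sum_insert ha, Finset.sum_insert ha, ← ih, @norm_add_sq_real]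
    have : inner ℝ (D a) (∑ i ∈ s, D i) = 0 := by
      rw [inner_sum]
      exact Finset.sum_eq_zero fun i hi => orth fun h => ha (h ▸ hi)
    rw [this]; ring

lemma summable_of_orthogonal [CompleteSpace H] {D : ℕ → H}
    (orth : Pairwise fun i j => inner ℝ (D i) (D j) = 0) (h : Summable fun n => ‖D n‖ ^ 2) :
    Summable D := by
  rw [summable_iff_vanishing_norm] at h ⊢
  intro ε hε
  obtain ⟨s, hs⟩ := h (ε ^ 2) (by positivity)
  refine ⟨s, fun t ht => ?_⟩
  have := hs t ht
  rw [← norm_sum_sq_of_orthogonal orth, Real.norm_of_nonneg (by positivity)] at this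
  exact lt_of_pow_lt_pow_left₀ 2 hε.le this

/-- Passage to the limit in a termwise energy inequality along an orthogonal sequence. -/
lemma exists_hasSum_of_energy [CompleteSpace H] {D : ℕ → H} {m : H} {a : ℕ → ℝ} {A : ℝ}
    (orth : Pairwise fun i j => inner ℝ (D i) (D j) = 0)
    (hE : ∀ n, ‖D n‖ ^ 2 ≤ inner ℝ (D n) m + a n) (hA : ∀ N, ∑ n ∈ Finset.range N, a n ≤ A) :
    Summable (fun n => ‖D n‖ ^ 2) ∧ ∃ d, HasSum D d ∧ ‖d‖ ^ 2 ≤ inner ℝ d m + A := by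
  have key : ∀ N, ‖∑ n ∈ Finset.range N, D n‖ ^ 2 ≤
      inner ℝ (∑ n ∈ Finset.range N, D n) m + A := by
    intro N
    rw [norm_sum_sq_of_orthogonal orth, sum_inner]
    calc _ ≤ ∑ n ∈ Finset.range N, (inner ℝ (D n) m + a n) := Finset.sum_le_sum fun n _ => hE n
      _ ≤ _ := by rw [Finset.sum_add_distrib]; linarith [hA N]
  -- The inequality for partial sums is quadratic on the left and linear on the right;
  -- Cauchy–Schwarz and Young turn it into a uniform bound.
  have bdd : ∀ N, ∑ n ∈ Finset.range N, ‖D n‖ ^ 2 ≤ ‖m‖ ^ 2 + 2 * A := by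
    intro N
    have h1 := key N
    have h2 := real_inner_le_norm (∑ n ∈ Finset.range N, D n) m
    rw [← norm_sum_sq_of_orthogonal orth]
    nlinarith [sq_nonneg (‖∑ n ∈ Finset.range N, D n‖ - ‖m‖)]
  have sq : Summable (fun n => ‖D n‖ ^ 2) :=
    summable_of_sum_range_le (fun _ => by positivity) bdd
  obtain ⟨d, hd⟩ := summable_of_orthogonal orth sq
  refine ⟨sq, d, hd, ?_⟩
  have t := hd.tendsto_sum_nat
  refine le_of_tendsto_of_tendsto' (t.norm.pow 2) ?_ key
  exact ((continuous_id.inner continuous_const).tendsto d |>.comp t).add_const A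

end Hilbert

section L2

variable {α β : Type*} [MeasurableSpace α] [MeasurableSpace β] {μ : Measure α} {ν : Measure β}

lemma inner_toLp {f g : α → ℝ} (hf : MemLp f 2 μ) (hg : MemLp g 2 μ) :
    inner ℝ (hf.toLp f) (hg.toLp g) = ∫ x, f x * g x ∂μ := by
  rw [L2.inner_def]
  apply integral_congr_ae
  filter_upwards [hf.coeFn_toLp, hg.coeFn_toLp] with x h1 h2
  rw [h1, h2, real_inner_eq_re_inner]
  simp [mul_comm]

lemma norm_toLp_sq {f : α → ℝ} (hf : MemLp f 2 μ) :
    ‖hf.toLp f‖ ^ 2 = ∫ x, f x ^ 2 ∂μ := by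
  rw [← real_inner_self_eq_norm_sq, inner_toLp hf hf]
  simp only [sq]

lemma MemLp.mul_prod_two [SFinite μ] [SFinite ν] {f : α → ℝ} {g : β → ℝ} (hf : MemLp f 2 μ)
    (hg : MemLp g 2 ν) : MemLp (fun z : α × β => f z.1 * g z.2) 2 (μ.prod ν) := by
  have m : AEStronglyMeasurable (fun z : α × β => f z.1 * g z.2) (μ.prod ν) :=
    hf.1.comp_fst.mul hg.1.comp_snd
  rw [memLp_two_iff_integrable_sq m]
  simp only [mul_pow]
  exact hf.integrable_sq.mul_prod hg.integrable_sq

/-- Expanding `∫ (M f - I)² ≥ 0` gives `M (M ∫ f² - I²) ≥ 0`; division by `M` needs the zero measure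
treated apart. -/
lemma sq_integral_le [IsFiniteMeasure μ] {f : α → ℝ} (hf : MemLp f 2 μ) :
    (∫ x, f x ∂μ) ^ 2 ≤ μ.real univ * ∫ x, f x ^ 2 ∂μ := by
  set I := ∫ x, f x ∂μ
  set M := μ.real univ
  have i1 : Integrable f μ := hf.integrable (by norm_num)
  have h : 0 ≤ ∫ x, (M * f x - I) ^ 2 ∂μ := integral_nonneg fun _ => sq_nonneg _
  have e : ∀ x, (M * f x - I) ^ 2 = M ^ 2 * f x ^ 2 - 2 * M * I * f x + I ^ 2 := fun x => by ring
  simp_rw [e] at h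
  have i2 : Integrable (fun x => M ^ 2 * f x ^ 2 - 2 * M * I * f x) μ :=
    (hf.integrable_sq.const_mul _).sub (i1.const_mul _)
  rw [integral_add i2 (integrable_const _),
    integral_sub (hf.integrable_sq.const_mul _) (i1.const_mul _), integral_const_mul,
    integral_const_mul, integral_const, smul_eq_mul] at h
  change 0 ≤ M ^ 2 * _ - 2 * M * I * I + M * I ^ 2 at h
  rcases (measureReal_nonneg (μ := μ) (s := univ)).eq_or_lt with h0 | h0
  · have : μ = 0 := by
      rw [eq_comm, measureReal_eq_zero_iff] at h0
      exact Measure.measure_univ_eq_zero.mp h0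
    simp [I, this]
  · have h1 : 0 ≤ M * (M * ∫ x, f x ^ 2 ∂μ - I ^ 2) := by nlinarith
    have := nonneg_of_mul_nonneg_right h1 h0
    linarith

/-- Integrating an `L²` function over a factor of finite measure gives an `L²` function. -/
lemma MemLp.integral_prod_right_two [SFinite μ] [IsFiniteMeasure ν] {w : α × β → ℝ}
    (hw : MemLp w 2 (μ.prod ν)) : MemLp (fun a => ∫ b, w (a, b) ∂ν) 2 μ := by
  have m := hw.1.integral_prod_right'
  rw [memLp_two_iff_integrable_sq m]
  refine Integrable.mono' (hw.integrable_sq.integral_prod_left.const_mul (ν.real univ))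
    (m.pow 2) ?_
  filter_upwards [hw.integrable_sq.prod_right_ae, hw.1.prodMk_left] with a ha hm
  rw [Real.norm_of_nonneg (sq_nonneg _)]
  exact sq_integral_le ((memLp_two_iff_integrable_sq hm).mpr ha)

end L2

/-! ### Trigonometric integrals. -/

lemma integral_cos_int_mul_pi (j : ℤ) :
    ∫ x in (0 : ℝ)..1, Real.cos (j * Real.pi * x) = if j = 0 then 1 else 0 := by
  split_ifs with h
  · simp [h]
  · have hj : (j : ℝ) * Real.pi ≠ 0 := mul_ne_zero (by exact_mod_cast h) Real.pi_ne_zero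
    rw [intervalIntegral.integral_comp_mul_left (fun y => Real.cos y) hj, integral_cos, mul_one,
      Real.sin_int_mul_pi]
    simp

/-- The frequencies `(n+1)π` of the Dirichlet Laplacian on `(0,1)`. -/
noncomputable def freq (n : ℕ) : ℝ := ((n + 1 : ℕ) : ℝ) * Real.pi

lemma one_le_freq (n : ℕ) : 1 ≤ freq n := by
  have h1 : (1 : ℝ) ≤ ((n + 1 : ℕ) : ℝ) := by push_cast; linarith [Nat.cast_nonneg (α := ℝ) n]
  have h2 := Real.pi_gt_three
  rw [freq]; nlinarith

lemma sin_freq (n : ℕ) : Real.sin (freq n) = 0 := Real.sin_nat_mul_pi (n + 1)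

lemma integral_cos_freq_sub (n k : ℕ) :
    ∫ x in (0 : ℝ)..1, Real.cos ((freq n - freq k) * x) = if n = k then 1 else 0 := by
  have := integral_cos_int_mul_pi ((n : ℤ) - k)
  have e : (((n : ℤ) - k : ℤ) : ℝ) * Real.pi = freq n - freq k := by
    rw [freq, freq]; push_cast; ring
  rw [e] at this
  rw [this]; congr 1; simp [sub_eq_zero]

lemma integral_cos_freq_add (n k : ℕ) :
    ∫ x in (0 : ℝ)..1, Real.cos ((freq n + freq k) * x) = 0 := by
  have := integral_cos_int_mul_pi ((n : ℤ) + k + 2)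
  have e : (((n : ℤ) + k + 2 : ℤ) : ℝ) * Real.pi = freq n + freq k := by
    rw [freq, freq]; push_cast; ring
  rw [e, if_neg (by omega)] at this
  exact this

lemma integral_sin_mul_sin_freq (n k : ℕ) :
    ∫ x in Ioo (0 : ℝ) 1, Real.sin (freq n * x) * Real.sin (freq k * x) =
      if n = k then 1 / 2 else 0 := by
  rw [← integral_Ioc_eq_integral_Ioo, ← intervalIntegral.integral_of_le zero_le_one]
  have e : ∀ x, Real.sin (freq n * x) * Real.sin (freq k * x) =
      (1 / 2) * (Real.cos ((freq n - freq k) * x) - Real.cos ((freq n + freq k) * x)) := by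
    intro x
    rw [sub_mul, add_mul, Real.cos_sub, Real.cos_add]; ring
  simp_rw [e]
  rw [intervalIntegral.integral_const_mul, intervalIntegral.integral_sub
    (Continuous.intervalIntegrable (by fun_prop) _ _)
    (Continuous.intervalIntegrable (by fun_prop) _ _), integral_cos_freq_sub,
    integral_cos_freq_add]
  split_ifs <;> norm_num

lemma integral_cos_mul_cos_freq (n k : ℕ) :
    ∫ x in Ioo (0 : ℝ) 1, Real.cos (freq n * x) * Real.cos (freq k * x) =
      if n = k then 1 / 2 else 0 := by
  rw [← integral_Ioc_eq_integral_Ioo, ← intervalIntegral.integral_of_le zero_le_one]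
  have e : ∀ x, Real.cos (freq n * x) * Real.cos (freq k * x) =
      (1 / 2) * (Real.cos ((freq n - freq k) * x) + Real.cos ((freq n + freq k) * x)) := by
    intro x
    rw [sub_mul, add_mul, Real.cos_sub, Real.cos_add]; ring
  simp_rw [e]
  rw [intervalIntegral.integral_const_mul, intervalIntegral.integral_add
    (Continuous.intervalIntegrable (by fun_prop) _ _)
    (Continuous.intervalIntegrable (by fun_prop) _ _), integral_cos_freq_sub,
    integral_cos_freq_add]
  split_ifs <;> norm_num

lemma hasDerivAt_sin_mul (l x : ℝ) :
    HasDerivAt (fun y => Real.sin (l * y)) (l * Real.cos (l * x)) x := by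
  simpa [mul_comm] using ((hasDerivAt_id x).const_mul l).sin

/-- The sum is the integral of the derivative of a product of sines, which vanishes at both ends.
This antisymmetry is `⟨uₓ, u⟩ = 0` at the level of modes. -/
lemma integral_cos_mul_sin_freq (n k : ℕ) :
    freq n * (∫ x in Ioo (0 : ℝ) 1, Real.cos (freq n * x) * Real.sin (freq k * x)) +
      freq k * (∫ x in Ioo (0 : ℝ) 1, Real.cos (freq k * x) * Real.sin (freq n * x)) = 0 := by
  simp only [← integral_Ioc_eq_integral_Ioo, ← intervalIntegral.integral_of_le (zero_le_one' ℝ)]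
  rw [← intervalIntegral.integral_const_mul, ← intervalIntegral.integral_const_mul,
    ← intervalIntegral.integral_add (Continuous.intervalIntegrable (by fun_prop) _ _)
    (Continuous.intervalIntegrable (by fun_prop) _ _),
    intervalIntegral.integral_eq_sub_of_hasDerivAt
      (f := fun x => Real.sin (freq n * x) * Real.sin (freq k * x)) (fun x _ => ?_)
      (Continuous.intervalIntegrable (by fun_prop) _ _)]
  · simp [sin_freq]
  · refine ((hasDerivAt_sin_mul (freq n) x).mul (hasDerivAt_sin_mul (freq k) x)).congr_deriv ?_
    ring

/-- The factor `1/2` is `∫ sin²`: the orthonormal functions are `√2 sin`. -/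
lemma bessel_sin {f : ℝ → ℝ} (hf : MemLp f 2 (volume.restrict (Ioo (0 : ℝ) 1))) (N : ℕ) :
    ∑ n ∈ Finset.range N, (∫ x in Ioo (0 : ℝ) 1, f x * Real.sin (freq n * x)) ^ 2 ≤
      (1 / 2) * ∫ x in Ioo (0 : ℝ) 1, f x ^ 2 := by
  have hs : ∀ n, MemLp (fun x => Real.sqrt 2 * Real.sin (freq n * x)) 2
      (volume.restrict (Ioo (0:ℝ) 1)) := fun n => memL2Space_of_continuous (by fun_prop)
  have on : Orthonormal ℝ fun n => (hs n).toLp _ := by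
    rw [orthonormal_iff_ite]
    intro i j
    rw [inner_toLp]
    have e : ∀ x, Real.sqrt 2 * Real.sin (freq i * x) * (Real.sqrt 2 * Real.sin (freq j * x)) =
        2 * (Real.sin (freq i * x) * Real.sin (freq j * x)) := by
      intro x
      have := Real.mul_self_sqrt (zero_le_two (α := ℝ))
      linear_combination (Real.sin (freq i * x) * Real.sin (freq j * x)) * this
    simp_rw [e]
    rw [integral_const_mul, integral_sin_mul_sin_freq]
    split_ifs <;> norm_num
  have := on.sum_inner_products_le (hf.toLp f) (s := Finset.range N)
  rw [norm_toLp_sq] at this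
  have e : ∀ n, ‖inner ℝ ((hs n).toLp _) (hf.toLp f)‖ ^ 2 =
      2 * (∫ x in Ioo (0 : ℝ) 1, f x * Real.sin (freq n * x)) ^ 2 := by
    intro n
    rw [inner_toLp, Real.norm_eq_abs, sq_abs]
    have e2 : ∀ x, Real.sqrt 2 * Real.sin (freq n * x) * f x =
        Real.sqrt 2 * (f x * Real.sin (freq n * x)) := fun x => by ring
    simp_rw [e2]
    rw [integral_const_mul, mul_pow, Real.sq_sqrt zero_le_two]
  simp_rw [e] at this
  rw [← Finset.mul_sum] at this
  linarith

/-! ### Sine modes of `u`, its weak derivative and the parabolic energy inequality. -/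

lemma MemL2Q.mul_continuous {T : ℝ} {w : ℝ → ℝ → ℝ} (hw : MemL2Q T w) {φ : ℝ → ℝ}
    (hφ : Continuous φ) : MemLp (fun z : ℝ × ℝ => w z.1 z.2 * φ z.2) 2 (cylMeasure T) := by
  obtain ⟨c, hc⟩ := (isCompact_Icc (a := (0:ℝ)) (b := 1)).exists_bound_of_continuousOn
    hφ.continuousOn
  have hw' := memL2Q_iff.mp hw
  refine MemLp.of_le_mul (c := c) hw'
    (hw'.1.mul (hφ.comp continuous_snd).aestronglyMeasurable) ?_
  filter_upwards [ae_cyl_mem T] with z hz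
  rw [norm_mul, mul_comm]
  exact mul_le_mul_of_nonneg_right (hc _ (Ioo_subset_Icc_self hz.2)) (norm_nonneg _)

lemma integrable_mul_two {α : Type*} [MeasurableSpace α] {μ : Measure α} {f g : α → ℝ}
    (hf : MemLp f 2 μ) (hg : MemLp g 2 μ) : Integrable (fun x => f x * g x) μ :=
  hf.integrable_mul hg

/-- Passing from slices to the product needs a measurable zero set, hence the detour through a
measurable representative. -/
lemma ae_prod_eq_zero_of_ae_ae {α β : Type*} [MeasurableSpace α] [MeasurableSpace β]
    {μ : Measure α} {ν : Measure β} [SFinite μ] [SFinite ν] {w : α × β → ℝ}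
    (hw : AEStronglyMeasurable w (μ.prod ν)) (h : ∀ᵐ a ∂μ, ∀ᵐ b ∂ν, w (a, b) = 0) :
    ∀ᵐ z ∂(μ.prod ν), w z = 0 := by
  have m := hw.stronglyMeasurable_mk
  have key : ∀ᵐ z ∂(μ.prod ν), hw.mk w z = 0 := by
    refine (Measure.ae_prod_iff_ae_ae (p := fun z => hw.mk w z = 0)
      (m.measurable (measurableSet_singleton 0))).mpr ?_
    filter_upwards [h, Measure.ae_ae_of_ae_prod hw.ae_eq_mk] with a h1 h2
    filter_upwards [h1, h2] with b h3 h4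
    rw [← h4, h3]
  filter_upwards [key, hw.ae_eq_mk] with z h1 h2
  rw [h2, h1]

/-- The moment `t ↦ ∫₀¹ w(t,x) φ(x) dx`. -/
noncomputable def moment (w : ℝ → ℝ → ℝ) (φ : ℝ → ℝ) (t : ℝ) : ℝ :=
  ∫ x in Ioo (0 : ℝ) 1, w t x * φ x

lemma MemL2Q.memLp_moment {T : ℝ} {w : ℝ → ℝ → ℝ} (hw : MemL2Q T w) {φ : ℝ → ℝ}
    (hφ : Continuous φ) : MemLp (moment w φ) 2 (volume.restrict (Ioo (0 : ℝ) T)) :=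
  MemLp.integral_prod_right_two (hw.mul_continuous hφ)

lemma MemL2Q.integral_mul_tensor {T : ℝ} {w : ℝ → ℝ → ℝ} (hw : MemL2Q T w) {φ b : ℝ → ℝ}
    (hφ : Continuous φ) (hb : MemLp b 2 (volume.restrict (Ioo (0 : ℝ) T))) :
    Integrable (fun z : ℝ × ℝ => w z.1 z.2 * (b z.1 * φ z.2)) (cylMeasure T) ∧
    ∫ z, w z.1 z.2 * (b z.1 * φ z.2) ∂(cylMeasure T) =
      ∫ t in Ioo (0 : ℝ) T, b t * moment w φ t := by
  have hbφ : MemLp (fun z : ℝ × ℝ => b z.1 * φ z.2) 2 (cylMeasure T) :=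
    MemLp.mul_prod_two hb (memL2Space_of_continuous hφ)
  have int := (memL2Q_iff.mp hw).integrable_mul hbφ
  refine ⟨int, (integral_prod _ int).trans ?_⟩
  congr 1; ext t
  rw [moment, ← integral_const_mul]
  congr 1; ext x
  simp only [Pi.mul_apply, Function.uncurry]; ring

/-- A weak solution of `c' = D`, `c(0) = c₀` is the primitive of `D`. -/
lemma ae_eq_primitive_of_weak {T : ℝ} (hT : 0 ≤ T) {c D : ℝ → ℝ} {c₀ : ℝ}
    (hc : IntegrableOn c (Ioo 0 T)) (hD : IntegrableOn D (Ioo 0 T))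
    (H : ∀ b b' : ℝ → ℝ, Continuous b' → (∀ t, HasDerivAt b (b' t) t) → b T = 0 →
      (∫ t in Ioo (0 : ℝ) T, b' t * c t) + ∫ t in Ioo (0 : ℝ) T, b t * D t = -(b 0 * c₀)) :
    ∀ᵐ t ∂(volume.restrict (Ioo (0 : ℝ) T)), c t = c₀ + ∫ s in (0 : ℝ)..t, D s := by
  have hD' : IntervalIntegrable D volume 0 T :=
    (intervalIntegrable_iff_integrableOn_Ioo_of_le hT).mpr hD
  have cY : ContinuousOn (fun t => c₀ + ∫ s in (0 : ℝ)..t, D s) (Icc 0 T) := by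
    refine continuousOn_const.add ?_
    have := intervalIntegral.continuousOn_primitive_interval' hD' (a := 0) (by simp)
    rwa [uIcc_of_le hT] at this
  have iY : IntegrableOn (fun t => c₀ + ∫ s in (0 : ℝ)..t, D s) (Ioo 0 T) :=
    (cY.integrableOn_Icc).mono_set Ioo_subset_Icc_self
  have key := isOpen_Ioo.ae_eq_zero_of_integral_contDiff_smul_eq_zero (μ := volume)
    (hc.sub iY).locallyIntegrableOn (U := Ioo 0 T) fun g hg _ hsupp => ?_
  · rw [ae_restrict_iff' measurableSet_Ioo]
    filter_upwards [key] with t ht h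
    exact sub_eq_zero.mp (ht h)
  have cg := hg.continuous
  -- Every smooth `g` supported in `(0,T)` is the derivative of an admissible multiplier: basing the
  -- primitive at `T` makes `b T = 0`. Comparing the hypothesis with integration by parts against
  -- the candidate shows that the difference is orthogonal to `g`.
  set b : ℝ → ℝ := fun t => ∫ s in T..t, g s with hb
  have db : ∀ t, HasDerivAt b (g t) t := fun t =>
    intervalIntegral.integral_hasDerivAt_right (cg.intervalIntegrable _ _)
      (cg.stronglyMeasurableAtFilter _ _) cg.continuousAt
  have h1 := H b g cg db (by simp [hb])
  have cb : Continuous b := continuous_iff_continuousAt.mpr fun t => (db t).continuousAt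
  have h2 := integral_primitive_mul_add (c₁ := b 0) (c₂ := c₀) (cg.intervalIntegrable 0 T) hD'
  have hb0 : ∀ t, b 0 + ∫ s in (0:ℝ)..t, g s = b t := fun t =>
    intervalIntegral.integral_add_adjacent_intervals (cg.intervalIntegrable _ _)
      (cg.intervalIntegrable _ _)
  simp only [hb0] at h2
  have bT : b T = 0 := by simp [hb]
  have bdd : ∀ {f h : ℝ → ℝ}, Continuous f → IntegrableOn h (Ioo 0 T) →
      IntegrableOn (fun t => f t * h t) (Ioo 0 T) := by
    intro f h hf hh
    obtain ⟨M, hM⟩ := (isCompact_Icc (a := (0:ℝ)) (b := T)).exists_bound_of_continuousOn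
      hf.continuousOn
    refine Integrable.bdd_mul (c := M) hh hf.aestronglyMeasurable ?_
    filter_upwards [ae_restrict_mem measurableSet_Ioo] with x hx
    exact hM x (Ioo_subset_Icc_self hx)
  rw [bT, zero_mul, zero_sub, intervalIntegral.integral_of_le hT, integral_Ioc_eq_integral_Ioo,
    integral_add (bdd cg iY) (bdd cb hD)] at h2
  rw [← setIntegral_eq_integral_of_forall_compl_eq_zero (s := Ioo 0 T)]
  · simp only [smul_eq_mul, Pi.sub_apply, mul_sub]
    rw [integral_sub (bdd cg hc) (bdd cg iY)]
    linarith
  · intro x hx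
    rw [image_eq_zero_of_notMem_tsupport (fun h => hx (hsupp h)), zero_smul]

/-- The integral is `(c(T)² - c₀²)/2` for the continuous representative; the square at time `T` is
dropped. -/
lemma neg_sq_le_integral_mul_of_primitive {T : ℝ} (hT : 0 ≤ T) {c D : ℝ → ℝ} {c₀ : ℝ}
    (hD : IntegrableOn D (Ioo 0 T))
    (h : ∀ᵐ t ∂(volume.restrict (Ioo (0 : ℝ) T)), c t = c₀ + ∫ s in (0 : ℝ)..t, D s) :
    -c₀ ^ 2 / 2 ≤ ∫ t in Ioo (0 : ℝ) T, c t * D t := by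
  have hD' : IntervalIntegrable D volume 0 T :=
    (intervalIntegrable_iff_integrableOn_Ioo_of_le hT).mpr hD
  have h1 := integral_primitive_mul_self (c := c₀) hD'
  rw [intervalIntegral.integral_of_le hT, integral_Ioc_eq_integral_Ioo] at h1
  have : ∫ t in Ioo (0 : ℝ) T, c t * D t =
      ∫ t in Ioo (0 : ℝ) T, (c₀ + ∫ s in (0 : ℝ)..t, D s) * D t := by
    apply integral_congr_ae
    filter_upwards [h] with t ht
    rw [ht]
  rw [this, h1]
  nlinarith [sq_nonneg (c₀ + ∫ s in (0 : ℝ)..T, D s)]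

/-- Energy inequality for the sine modes of the parabolic component. -/
lemma IsTranspositionSolution.mode_energy {T : ℝ} (hT : 0 < T) {ρ₀ u₀ p : ℝ → ℝ}
    {ρ u : ℝ → ℝ → ℝ} (hs : IsTranspositionSolution T ρ₀ u₀ p ρ u) (n : ℕ) :
    freq n ^ 2 * (∫ t in Ioo (0 : ℝ) T, moment u (fun x => Real.sin (freq n * x)) t ^ 2) ≤
      freq n * (∫ t in Ioo (0 : ℝ) T, moment u (fun x => Real.sin (freq n * x)) t *
        moment (fun t x => u t x + ρ t x) (fun x => Real.cos (freq n * x)) t) +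
      (∫ x in Ioo (0 : ℝ) 1, u₀ x * Real.sin (freq n * x)) ^ 2 / 2 := by
  set l := freq n with hl
  have hu := hs.memL2Q_snd
  have hm : MemL2Q T (fun t x => u t x + ρ t x) :=
    memL2Q_iff.mpr ((memL2Q_iff.mp hs.memL2Q_snd).add (memL2Q_iff.mp hs.memL2Q_fst))
  set c := moment u (fun x => Real.sin (l * x)) with hc
  set m := moment (fun t x => u t x + ρ t x) (fun x => Real.cos (l * x)) with hmm
  have csin : Continuous fun x => Real.sin (l * x) := by fun_prop
  have ccos : Continuous fun x => Real.cos (l * x) := by fun_prop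
  have Lc : MemLp c 2 (volume.restrict (Ioo (0:ℝ) T)) := hu.memLp_moment csin
  have Lm : MemLp m 2 (volume.restrict (Ioo (0:ℝ) T)) := hm.memLp_moment ccos
  have LD : MemLp (fun t => l * m t - l ^ 2 * c t) 2 (volume.restrict (Ioo (0:ℝ) T)) :=
    (Lm.const_mul l).sub (Lc.const_mul (l ^ 2))
  have iD : IntegrableOn (fun t => l * m t - l ^ 2 * c t) (Ioo 0 T) :=
    LD.integrable (by norm_num)
  -- The mode solves `c' = l m - l² c` with initial value the sine coefficient of `u₀`; multiplying
  -- by `c` and integrating gives the claim.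
  have rep := ae_eq_primitive_of_weak hT.le (c₀ := ∫ x in Ioo (0 : ℝ) 1, u₀ x * Real.sin (l * x))
    (Lc.integrable (by norm_num)) iD fun b b' hb' hb hbT => by
      have cb : Continuous b := continuous_iff_continuousAt.mpr fun t => (hb t).continuousAt
      have Lb : MemLp b 2 (volume.restrict (Ioo (0:ℝ) T)) := memL2Time_of_continuous cb
      have Lb' : MemLp b' 2 (volume.restrict (Ioo (0:ℝ) T)) := memL2Time_of_continuous hb'
      have w := hs.heat_weak hT.le (n + 1) hb' hb hbT hl
      obtain ⟨i1, e1⟩ := hu.integral_mul_tensor csin Lb'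
      obtain ⟨i2, e2⟩ := hu.integral_mul_tensor csin Lb
      obtain ⟨i3, e3⟩ := hm.integral_mul_tensor ccos Lb
      have e : ∀ z : ℝ × ℝ, (u z.1 z.2 * (-(b' z.1 * Real.sin (l * z.2)) +
          l ^ 2 * (b z.1 * Real.sin (l * z.2)))
          - l * ((u z.1 z.2 + ρ z.1 z.2) * (b z.1 * Real.cos (l * z.2)))) =
          (l ^ 2 * (u z.1 z.2 * (b z.1 * Real.sin (l * z.2)))
            - u z.1 z.2 * (b' z.1 * Real.sin (l * z.2)))
          - l * ((u z.1 z.2 + ρ z.1 z.2) * (b z.1 * Real.cos (l * z.2))) := fun z => by ring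
      simp_rw [e] at w
      have i4 : Integrable (fun z : ℝ × ℝ => l ^ 2 * (u z.1 z.2 * (b z.1 * Real.sin (l * z.2)))
            - u z.1 z.2 * (b' z.1 * Real.sin (l * z.2))) (cylMeasure T) :=
        (i2.const_mul _).sub i1
      rw [integral_sub i4 (i3.const_mul _), integral_sub (i2.const_mul _) i1, integral_const_mul,
        integral_const_mul, e1, e2, e3, intervalIntegral.integral_of_le zero_le_one,
        integral_Ioc_eq_integral_Ioo] at w
      have e5 : ∫ t in Ioo (0:ℝ) T, b t * (l * m t - l ^ 2 * c t) =
          l * (∫ t in Ioo (0:ℝ) T, b t * m t) - l ^ 2 * ∫ t in Ioo (0:ℝ) T, b t * c t := by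
        rw [← integral_const_mul, ← integral_const_mul,
          ← integral_sub ((integrable_mul_two Lb Lm).const_mul _) ((integrable_mul_two Lb Lc).const_mul _)]
        congr 1; ext t; ring
      rw [e5]
      linarith
  have en := neg_sq_le_integral_mul_of_primitive hT.le iD rep
  have hlin : ∫ t in Ioo (0:ℝ) T, c t * (l * m t - l ^ 2 * c t) =
      l * (∫ t in Ioo (0:ℝ) T, c t * m t) - l ^ 2 * ∫ t in Ioo (0:ℝ) T, c t ^ 2 := by
    rw [← integral_const_mul, ← integral_const_mul,
      ← integral_sub ((integrable_mul_two Lc Lm).const_mul l) (Lc.integrable_sq.const_mul (l ^ 2))]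
    congr 1; ext t; ring
  rw [hlin] at en
  linarith

/-- An `L²` function on the cylinder orthogonal to all `b(t) sin((n+1)πx)` vanishes. -/
lemma MemL2Q.ae_eq_zero_of_sine {T : ℝ} {w : ℝ → ℝ → ℝ} (hw : MemL2Q T w)
    (h : ∀ n, ∀ b : ℝ → ℝ, MemLp b 2 (volume.restrict (Ioo (0 : ℝ) T)) →
      ∫ z, w z.1 z.2 * (b z.1 * Real.sin (freq n * z.2)) ∂(cylMeasure T) = 0) :
    ∀ᵐ z ∂(cylMeasure T), w z.1 z.2 = 0 := by
  have hz : ∀ᵐ t ∂(volume.restrict (Ioo (0 : ℝ) T)), ∀ n,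
      moment w (fun x => Real.sin (freq n * x)) t = 0 := by
    rw [ae_all_iff]
    intro n
    have cs : Continuous fun x => Real.sin (freq n * x) := by fun_prop
    have L := hw.memLp_moment cs
    -- The moment is itself an admissible `b`, so its square has zero integral.
    have := (hw.integral_mul_tensor cs L).2.symm.trans (h n _ L)
    rw [integral_eq_zero_iff_of_nonneg (fun t => mul_self_nonneg _) (L.integrable_mul L)] at this
    filter_upwards [this] with t ht
    exact mul_self_eq_zero.mp ht
  have hw' := memL2Q_iff.mp hw
  have iw : Integrable (Function.uncurry w) (cylMeasure T) := hw'.integrable (by norm_num)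
  refine ae_prod_eq_zero_of_ae_ae hw'.1 ?_
  filter_upwards [hz, iw.prod_right_ae] with t ht hi
  refine ae_eq_zero_of_sin_integral_zero hi fun n => ?_
  rcases n with _ | n
  · simp
  · exact ht n

lemma integral_tensor_mul_tensor {T : ℝ} (a b φ ψ : ℝ → ℝ) :
    ∫ z, (a z.1 * φ z.2) * (b z.1 * ψ z.2) ∂(cylMeasure T) =
      (∫ t in Ioo (0 : ℝ) T, a t * b t) * ∫ x in Ioo (0 : ℝ) 1, φ x * ψ x := by
  rw [← integral_prod_mul (fun t => a t * b t) (fun x => φ x * ψ x)]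
  congr 1; ext z; ring

/-- The sine vanishes at both ends, so `σ` needs no boundary condition. Hence the derivative of `u`
obtained in the limit also encodes the Dirichlet condition. -/
lemma integral_sine_by_parts {T : ℝ} (n : ℕ) {a : ℝ → ℝ}
    (ha : MemLp a 2 (volume.restrict (Ioo (0 : ℝ) T))) {σ σx : ℝ → ℝ → ℝ}
    (hσ : Continuous (Function.uncurry σ)) (hσx : Continuous (Function.uncurry σx))
    (hd : ∀ t x, HasDerivAt (fun y => σ t y) (σx t x) x) :
    ∫ z, (a z.1 * Real.sin (freq n * z.2)) * σx z.1 z.2 ∂(cylMeasure T) =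
      -∫ z, (freq n * a z.1 * Real.cos (freq n * z.2)) * σ z.1 z.2 ∂(cylMeasure T) := by
  have i1 : Integrable (fun z : ℝ × ℝ => (a z.1 * Real.sin (freq n * z.2)) * σx z.1 z.2)
      (cylMeasure T) :=
    integrable_mul_two (MemLp.mul_prod_two ha (memL2Space_of_continuous
      (a := fun x => Real.sin (freq n * x)) (by fun_prop)))
      (memL2Q_iff.mp (memL2Q_of_continuous hσx))
  have i2 : Integrable (fun z : ℝ × ℝ => (freq n * a z.1 * Real.cos (freq n * z.2)) * σ z.1 z.2)
      (cylMeasure T) :=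
    integrable_mul_two (MemLp.mul_prod_two (ha.const_mul (freq n)) (memL2Space_of_continuous
      (a := fun x => Real.cos (freq n * x)) (by fun_prop)))
      (memL2Q_iff.mp (memL2Q_of_continuous hσ))
  rw [eq_neg_iff_add_eq_zero, ← integral_add i1 i2]
  refine (integral_prod _ (i1.add i2)).trans (integral_eq_zero_of_ae (ae_of_all _ fun t => ?_))
  have e : ∀ x, a t * Real.sin (freq n * x) * σx t x + freq n * a t * Real.cos (freq n * x) * σ t x
      = a t * (freq n * Real.cos (freq n * x) * σ t x + Real.sin (freq n * x) * σx t x) :=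
    fun x => by ring
  have c1 : Continuous (σ t) := hσ.uncurry_left t
  have c2 : Continuous (σx t) := hσx.uncurry_left t
  simp only [Pi.add_apply, e, Pi.zero_apply]
  rw [integral_const_mul, ← integral_Ioc_eq_integral_Ioo,
    ← intervalIntegral.integral_of_le zero_le_one,
    intervalIntegral.integral_eq_sub_of_hasDerivAt
      (f := fun x => Real.sin (freq n * x) * σ t x)
      (fun x _ => (hasDerivAt_sin_mul (freq n) x).mul (hd t x))
      (Continuous.intervalIntegrable (by fun_prop) _ _)]
  simp [sin_freq]

/-- The parabolic component has a square integrable weak space derivative `d`, with the energy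
inequality. -/
lemma IsTranspositionSolution.exists_weak_derivative {T : ℝ} (hT : 0 < T) {ρ₀ u₀ p : ℝ → ℝ}
    {ρ u : ℝ → ℝ → ℝ} (hs : IsTranspositionSolution T ρ₀ u₀ p ρ u) (hu₀ : MemL2Space u₀) :
    ∃ d : ℝ → ℝ → ℝ, MemL2Q T d ∧
      (∀ σ σx : ℝ → ℝ → ℝ, Continuous (Function.uncurry σ) → Continuous (Function.uncurry σx) →
        (∀ t x, HasDerivAt (fun y => σ t y) (σx t x) x) →
        ∫ z, u z.1 z.2 * σx z.1 z.2 ∂(cylMeasure T) =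
          -∫ z, d z.1 z.2 * σ z.1 z.2 ∂(cylMeasure T)) ∧
      ∫ z, d z.1 z.2 ^ 2 ∂(cylMeasure T) ≤
        (∫ z, d z.1 z.2 * ρ z.1 z.2 ∂(cylMeasure T)) + (1 / 2) * ∫ x in (0 : ℝ)..1, u₀ x ^ 2 := by
  have Lu : MemLp (fun z : ℝ × ℝ => u z.1 z.2) 2 (cylMeasure T) := memL2Q_iff.mp hs.memL2Q_snd
  have Lρ : MemLp (fun z : ℝ × ℝ => ρ z.1 z.2) 2 (cylMeasure T) := memL2Q_iff.mp hs.memL2Q_fst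
  have Lm : MemLp (fun z : ℝ × ℝ => u z.1 z.2 + ρ z.1 z.2) 2 (cylMeasure T) := Lu.add Lρ
  have hm : MemL2Q T (fun t x => u t x + ρ t x) := memL2Q_iff.mpr Lm
  set c : ℕ → ℝ → ℝ := fun n => moment u (fun x => Real.sin (freq n * x)) with hc
  have csin : ∀ n, Continuous fun x => Real.sin (freq n * x) := fun n => by fun_prop
  have ccos : ∀ n, Continuous fun x => Real.cos (freq n * x) := fun n => by fun_prop
  have Lc : ∀ n, MemLp (c n) 2 (volume.restrict (Ioo (0:ℝ) T)) := fun n =>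
    hs.memL2Q_snd.memLp_moment (csin n)
  -- Terms of the sine expansion of `u`, the factor `2` being `1 / ∫ sin²`; the cosine terms below
  -- are their space derivatives.
  have LU : ∀ n, MemLp (fun z : ℝ × ℝ => (2 * c n z.1) * Real.sin (freq n * z.2)) 2
      (cylMeasure T) := fun n =>
    MemLp.mul_prod_two ((Lc n).const_mul 2) (memL2Space_of_continuous (csin n))
  have LD : ∀ n, MemLp (fun z : ℝ × ℝ => (freq n * (2 * c n z.1)) * Real.cos (freq n * z.2)) 2
      (cylMeasure T) := fun n =>
    MemLp.mul_prod_two (((Lc n).const_mul 2).const_mul (freq n))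
      (memL2Space_of_continuous (ccos n))
  set U : ℕ → Lp ℝ 2 (cylMeasure T) := fun n => (LU n).toLp _ with hU
  set D : ℕ → Lp ℝ 2 (cylMeasure T) := fun n => (LD n).toLp _ with hD
  have orthU : Pairwise fun i j => inner ℝ (U i) (U j) = 0 := fun i j hij => by
    simp only [hU]
    rw [inner_toLp, integral_tensor_mul_tensor (fun t => 2 * c i t) (fun t => 2 * c j t)
      (fun x => Real.sin (freq i * x)) (fun x => Real.sin (freq j * x)),
      integral_sin_mul_sin_freq, if_neg hij, mul_zero]
  have orthD : Pairwise fun i j => inner ℝ (D i) (D j) = 0 := fun i j hij => by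
    simp only [hD]
    rw [inner_toLp, integral_tensor_mul_tensor (fun t => freq i * (2 * c i t))
      (fun t => freq j * (2 * c j t)) (fun x => Real.cos (freq i * x))
      (fun x => Real.cos (freq j * x)), integral_cos_mul_cos_freq, if_neg hij, mul_zero]
  have normU : ∀ n, ‖U n‖ ^ 2 = 2 * ∫ t in Ioo (0:ℝ) T, c n t ^ 2 := fun n => by
    rw [← real_inner_self_eq_norm_sq]
    simp only [hU]
    rw [inner_toLp, integral_tensor_mul_tensor (fun t => 2 * c n t) (fun t => 2 * c n t)
      (fun x => Real.sin (freq n * x)) (fun x => Real.sin (freq n * x)),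
      integral_sin_mul_sin_freq, if_pos rfl]
    have : ∀ t, 2 * c n t * (2 * c n t) = 4 * c n t ^ 2 := fun t => by ring
    simp_rw [this]
    rw [integral_const_mul]; ring
  have normD : ∀ n, ‖D n‖ ^ 2 = 2 * (freq n ^ 2 * ∫ t in Ioo (0:ℝ) T, c n t ^ 2) := fun n => by
    rw [← real_inner_self_eq_norm_sq]
    simp only [hD]
    rw [inner_toLp, integral_tensor_mul_tensor (fun t => freq n * (2 * c n t))
      (fun t => freq n * (2 * c n t)) (fun x => Real.cos (freq n * x))
      (fun x => Real.cos (freq n * x)), integral_cos_mul_cos_freq, if_pos rfl]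
    have : ∀ t, freq n * (2 * c n t) * (freq n * (2 * c n t)) = (4 * freq n ^ 2) * c n t ^ 2 :=
      fun t => by ring
    simp_rw [this]
    rw [integral_const_mul]; ring
  -- Twice the energy inequality of the mode, rewritten in the space-time inner product; `Lm` is the
  -- class of `u + ρ`.
  have energy : ∀ n, ‖D n‖ ^ 2 ≤ inner ℝ (D n) (Lm.toLp _) +
      (∫ x in Ioo (0 : ℝ) 1, u₀ x * Real.sin (freq n * x)) ^ 2 := fun n => by
    have h1 := hs.mode_energy hT n
    have h2 : inner ℝ (D n) (Lm.toLp _) = 2 * (freq n * ∫ t in Ioo (0:ℝ) T, c n t *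
        moment (fun t x => u t x + ρ t x) (fun x => Real.cos (freq n * x)) t) := by
      simp only [hD]
      rw [inner_toLp, ← integral_const_mul, ← integral_const_mul]
      have := (hm.integral_mul_tensor (ccos n) (((Lc n).const_mul 2).const_mul (freq n))).2
      refine Eq.trans ?_ (this.trans ?_)
      · congr 1; ext z; ring
      · congr 1; ext t; ring
    rw [normD, h2]
    linarith
  obtain ⟨sq, d, hd, hdE⟩ := exists_hasSum_of_energy orthD energy (bessel_sin hu₀)
  have sqU : Summable fun n => ‖U n‖ ^ 2 := by
    refine Summable.of_nonneg_of_le (fun _ => by positivity) (fun n => ?_) sq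
    rw [normU, normD]
    have h0 : 0 ≤ ∫ t in Ioo (0:ℝ) T, c n t ^ 2 := integral_nonneg fun _ => sq_nonneg _
    have h1 : 1 ≤ freq n ^ 2 := one_le_pow₀ (one_le_freq n)
    nlinarith
  obtain ⟨v, hv⟩ := summable_of_orthogonal orthU sqU
  -- The sine series converges to `u`: the difference has no sine component, and the sines are
  -- complete.
  have hvu : v = Lu.toLp _ := by
    have Lw : MemLp (fun z : ℝ × ℝ => u z.1 z.2 - v z) 2 (cylMeasure T) := Lu.sub (Lp.memLp v)
    have hw : MemL2Q T (fun t x => u t x - v (t, x)) := memL2Q_iff.mpr Lw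
    have z := hw.ae_eq_zero_of_sine fun k b hb => by
      have Lb : MemLp (fun z : ℝ × ℝ => b z.1 * Real.sin (freq k * z.2)) 2 (cylMeasure T) :=
        MemLp.mul_prod_two hb (memL2Space_of_continuous (csin k))
      have h1 : HasSum (fun n => inner ℝ (Lb.toLp _) (U n)) (inner ℝ (Lb.toLp _) v) :=
        (innerSL ℝ (Lb.toLp _)).hasSum hv
      have h2 : ∀ n, inner ℝ (Lb.toLp _) (U n) =
          (∫ t in Ioo (0:ℝ) T, b t * (2 * c n t)) * (if k = n then 1 / 2 else 0) := fun n => by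
        simp only [hU]
        rw [inner_toLp, integral_tensor_mul_tensor b (fun t => 2 * c n t)
          (fun x => Real.sin (freq k * x)) (fun x => Real.sin (freq n * x)),
          integral_sin_mul_sin_freq]
      have h3 := h1.unique (hasSum_single k fun n hn => by rw [h2, if_neg hn.symm, mul_zero])
      rw [h2, if_pos rfl] at h3
      have h4 : inner ℝ (Lb.toLp _) v =
          ∫ z, v z * (b z.1 * Real.sin (freq k * z.2)) ∂(cylMeasure T) := by
        conv_lhs => rw [← Lp.toLp_coeFn v (Lp.memLp v)]
        rw [inner_toLp]
        congr 1; ext z; ring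
      have h5 := (hs.memL2Q_snd.integral_mul_tensor (csin k) hb).2
      simp only [sub_mul, Prod.mk.eta]
      rw [integral_sub (integrable_mul_two Lu Lb) (integrable_mul_two (Lp.memLp v) Lb), ← h4, h3,
        h5, ← integral_mul_const, sub_eq_zero]
      congr 1; ext t; ring
    rw [← Lp.toLp_coeFn v (Lp.memLp v), MemLp.toLp_eq_toLp_iff]
    filter_upwards [z] with z hz
    exact (sub_eq_zero.mp hz).symm
  -- The matrix `⟨D i, U j⟩` is antisymmetric, so the product of equal partial sums is zero; pass to
  -- the limit. This removes `u` from the right side of the energy inequality.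
  have hdu : inner ℝ d (Lu.toLp _) = 0 := by
    rw [← hvu]
    have anti : ∀ i j, inner ℝ (D i) (U j) = -inner ℝ (D j) (U i) := fun i j => by
      simp only [hD, hU]
      rw [inner_toLp, inner_toLp, integral_tensor_mul_tensor (fun t => freq i * (2 * c i t))
        (fun t => 2 * c j t) (fun x => Real.cos (freq i * x)) (fun x => Real.sin (freq j * x)),
        integral_tensor_mul_tensor (fun t => freq j * (2 * c j t))
        (fun t => 2 * c i t) (fun x => Real.cos (freq j * x)) (fun x => Real.sin (freq i * x))]
      have e1 : ∀ t, freq i * (2 * c i t) * (2 * c j t) = freq i * (4 * (c i t * c j t)) :=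
        fun t => by ring
      have e2 : ∀ t, freq j * (2 * c j t) * (2 * c i t) = freq j * (4 * (c i t * c j t)) :=
        fun t => by ring
      simp_rw [e1, e2, integral_const_mul]
      linear_combination (4 * ∫ t in Ioo (0:ℝ) T, c i t * c j t) * integral_cos_mul_sin_freq i j
    have fin : ∀ N, inner ℝ (∑ n ∈ Finset.range N, D n) (∑ n ∈ Finset.range N, U n) = 0 := by
      intro N
      have h1 : inner ℝ (∑ n ∈ Finset.range N, D n) (∑ n ∈ Finset.range N, U n) =
          ∑ i ∈ Finset.range N, ∑ j ∈ Finset.range N, inner ℝ (D i) (U j) := by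
        rw [sum_inner]; simp_rw [inner_sum]
      have h2 : ∑ i ∈ Finset.range N, ∑ j ∈ Finset.range N, inner ℝ (D i) (U j) =
          -∑ i ∈ Finset.range N, ∑ j ∈ Finset.range N, inner ℝ (D i) (U j) := by
        conv_rhs => rw [Finset.sum_comm]
        rw [← Finset.sum_neg_distrib]
        refine Finset.sum_congr rfl fun i _ => ?_
        rw [← Finset.sum_neg_distrib]
        exact Finset.sum_congr rfl fun j _ => anti i j
      rw [h1]; linarith
    have lim := hd.tendsto_sum_nat.inner (𝕜 := ℝ) hv.tendsto_sum_nat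
    simp only [fin] at lim
    exact (tendsto_nhds_unique lim tendsto_const_nhds)
  refine ⟨fun t x => d (t, x), memL2Q_iff.mpr (Lp.memLp d), fun σ σx hσ hσx hder => ?_, ?_⟩
  · have Lσ : MemLp (fun z : ℝ × ℝ => σ z.1 z.2) 2 (cylMeasure T) :=
      memL2Q_iff.mp (memL2Q_of_continuous hσ)
    have Lσx : MemLp (fun z : ℝ × ℝ => σx z.1 z.2) 2 (cylMeasure T) :=
      memL2Q_iff.mp (memL2Q_of_continuous hσx)
    have h1 : HasSum (fun n => inner ℝ (Lσx.toLp _) (U n)) (inner ℝ (Lσx.toLp _) v) :=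
      (innerSL ℝ (Lσx.toLp _)).hasSum hv
    have h2 : HasSum (fun n => inner ℝ (Lσ.toLp _) (D n)) (inner ℝ (Lσ.toLp _) d) :=
      (innerSL ℝ (Lσ.toLp _)).hasSum hd
    have h3 : ∀ n, inner ℝ (Lσx.toLp _) (U n) = -inner ℝ (Lσ.toLp _) (D n) := fun n => by
      rw [real_inner_comm, real_inner_comm (D n)]
      simp only [hU, hD]
      rw [inner_toLp, inner_toLp]
      exact integral_sine_by_parts n ((Lc n).const_mul 2) hσ hσx hder
    simp only [h3] at h1
    have h4 := h1.unique h2.neg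
    rw [hvu, real_inner_comm, inner_toLp, real_inner_comm] at h4
    rw [h4, ← Lp.toLp_coeFn d (Lp.memLp d), inner_toLp, Lp.toLp_coeFn]
  · have h1 : ‖d‖ ^ 2 = ∫ z, d z ^ 2 ∂(cylMeasure T) := by
      conv_lhs => rw [← Lp.toLp_coeFn d (Lp.memLp d)]
      rw [norm_toLp_sq]
    have h2 : inner ℝ d (Lρ.toLp _) = ∫ z, d z * ρ z.1 z.2 ∂(cylMeasure T) := by
      conv_lhs => rw [← Lp.toLp_coeFn d (Lp.memLp d)]
      rw [inner_toLp]
    have h3 : Lm.toLp _ = Lu.toLp _ + Lρ.toLp _ := MemLp.toLp_add Lu Lρ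
    rw [h3, inner_add_right, hdu, zero_add, h1, h2] at hdE
    rw [intervalIntegral.integral_of_le zero_le_one, integral_Ioc_eq_integral_Ioo]
    exact hdE

/-! ### Characteristics of the transport equation with reinjection at `x = 0`. -/

/-- Lebesgue measure on the strip `ℝ × (0,1)`, as a product measure. -/
noncomputable abbrev stripMeasure : Measure (ℝ × ℝ) :=
  volume.prod (volume.restrict (Ioo (0 : ℝ) 1))

/-- A source term in characteristic coordinates `(s,x) = (t-x,x)`, supported in the cylinder. -/
structure IsCharSource (T : ℝ) (H : ℝ × ℝ → ℝ) : Prop where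
  meas : StronglyMeasurable H
  memLp : MemLp H 2 stripMeasure
  supp : ∀ s x, x ∈ Ioo (0 : ℝ) 1 → s + x ∉ Ioo 0 T → H (s, x) = 0

/-- The integral of the source along the characteristic `s`, up to the abscissa `x`. -/
noncomputable def charIntegral (H : ℝ × ℝ → ℝ) (s x : ℝ) : ℝ := ∫ y in (0 : ℝ)..x, H (s, y)

/-- The data entering at `x = 0` at time `s` for the first time. -/
noncomputable def inflowData (T : ℝ) (ρ₀ p : ℝ → ℝ) (H : ℝ × ℝ → ℝ) (s : ℝ) : ℝ :=
  (Ioo (-1 : ℝ) 0).indicator (fun s => ρ₀ (-s)) s + (Ioo (0 : ℝ) T).indicator p s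
    + charIntegral H (s - 1) 1

/-- The boundary value at `x = 0`, summed over the previous turns around the circle. -/
noncomputable def inflow (T : ℝ) (ρ₀ p : ℝ → ℝ) (H : ℝ × ℝ → ℝ) (N : ℕ) (s : ℝ) : ℝ :=
  ∑ j ∈ Finset.range (N + 1), inflowData T ρ₀ p H (s - j)

/-- The boundary value at `x = 1`. -/
noncomputable def outflow (T : ℝ) (ρ₀ p : ℝ → ℝ) (H : ℝ × ℝ → ℝ) (N : ℕ) (s : ℝ) : ℝ :=
  inflow T ρ₀ p H N (s - 1) + charIntegral H (s - 1) 1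

lemma ae_strip_mem : ∀ᵐ z ∂stripMeasure, z.2 ∈ Ioo (0 : ℝ) 1 := by
  have : ∀ᵐ x ∂(volume.restrict (Ioo (0:ℝ) 1)), x ∈ Ioo (0:ℝ) 1 := ae_restrict_mem measurableSet_Ioo
  exact Measure.quasiMeasurePreserving_snd.ae this

section Source

variable {T : ℝ} {H : ℝ × ℝ → ℝ}

lemma charIntegral_of_mem {s x : ℝ} (hx : 0 ≤ x) :
    charIntegral H s x = ∫ y in Ioo (0:ℝ) x, H (s, y) := by
  rw [charIntegral, intervalIntegral.integral_of_le hx, integral_Ioc_eq_integral_Ioo]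

lemma IsCharSource.ae_slice (h : IsCharSource T H) :
    ∀ᵐ s : ℝ, MemLp (fun x => H (s, x)) 2 (volume.restrict (Ioo (0 : ℝ) 1)) := by
  filter_upwards [h.memLp.integrable_sq.prod_right_ae, h.memLp.1.prodMk_left] with s h1 h2
  exact (memLp_two_iff_integrable_sq h2).mpr h1

lemma sq_charIntegral_le {s x : ℝ} (hx : x ∈ Icc (0 : ℝ) 1)
    (h : MemLp (fun x => H (s, x)) 2 (volume.restrict (Ioo (0 : ℝ) 1))) :
    charIntegral H s x ^ 2 ≤ ∫ y in Ioo (0 : ℝ) 1, H (s, y) ^ 2 := by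
  have sub : Ioo (0:ℝ) x ⊆ Ioo 0 1 := Ioo_subset_Ioo_right hx.2
  have h' : MemLp (fun x => H (s, x)) 2 (volume.restrict (Ioo (0 : ℝ) x)) :=
    h.mono_measure (Measure.restrict_mono_set _ sub)
  rw [charIntegral_of_mem hx.1]
  refine (sq_integral_le h').trans ?_
  have e : (volume.restrict (Ioo (0 : ℝ) x)).real univ = x := by
    simp [measureReal_restrict_apply, hx.1]
  rw [e]
  have h0 : 0 ≤ ∫ y in Ioo (0 : ℝ) x, H (s, y) ^ 2 := integral_nonneg fun _ => sq_nonneg _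
  have h1 : ∫ y in Ioo (0 : ℝ) x, H (s, y) ^ 2 ≤ ∫ y in Ioo (0 : ℝ) 1, H (s, y) ^ 2 :=
    setIntegral_mono_set h.integrable_sq (ae_of_all _ fun _ => sq_nonneg _) sub.eventuallyLE
  nlinarith [hx.2]

lemma IsCharSource.memLp_charIntegral (h : IsCharSource T H) :
    MemLp (fun z : ℝ × ℝ => charIntegral H z.1 z.2) 2 stripMeasure := by
  -- Replacing the variable upper limit by an indicator reduces joint measurability to that of a
  -- parametric integral over a fixed interval.
  set A : (ℝ × ℝ) × ℝ → ℝ :=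
    {q : (ℝ × ℝ) × ℝ | q.2 < q.1.2}.indicator (fun q => H (q.1.1, q.2)) with hA
  have mA : StronglyMeasurable A := by
    refine (h.meas.comp_measurable (by fun_prop)).indicator ?_
    exact measurableSet_lt (by fun_prop) (by fun_prop)
  have mG : StronglyMeasurable fun z : ℝ × ℝ => ∫ y in Ioo (0:ℝ) 1, A (z, y) :=
    mA.integral_prod_right'
  have eG : (fun z : ℝ × ℝ => ∫ y in Ioo (0:ℝ) 1, A (z, y)) =ᵐ[stripMeasure]
      fun z => charIntegral H z.1 z.2 := by
    filter_upwards [ae_strip_mem] with z hz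
    have e : ∀ y, A (z, y) = (Iio z.2).indicator (fun y => H (z.1, y)) y := fun y => by
      simp [hA, indicator]
    simp_rw [e]
    rw [setIntegral_indicator measurableSet_Iio, Ioo_inter_Iio, min_eq_right hz.2.le,
      charIntegral_of_mem hz.1.le]
  have m : AEStronglyMeasurable (fun z : ℝ × ℝ => charIntegral H z.1 z.2) stripMeasure :=
    mG.aestronglyMeasurable.congr eG
  rw [memLp_two_iff_integrable_sq m]
  have dom : Integrable (fun z : ℝ × ℝ => ∫ y in Ioo (0:ℝ) 1, H (z.1, y) ^ 2) stripMeasure :=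
    h.memLp.integrable_sq.integral_prod_left.comp_fst _
  refine Integrable.mono' dom (m.pow 2) ?_
  filter_upwards [ae_strip_mem, Measure.quasiMeasurePreserving_fst.ae h.ae_slice] with z hz h2
  rw [Real.norm_of_nonneg (sq_nonneg _)]
  exact sq_charIntegral_le (Ioo_subset_Icc_self hz) h2

lemma IsCharSource.memLp_total (h : IsCharSource T H) :
    MemLp (fun s => charIntegral H s 1) 2 volume := by
  simp_rw [charIntegral_of_mem zero_le_one]
  exact MemLp.integral_prod_right_two h.memLp

lemma IsCharSource.integral_sq_total_le (h : IsCharSource T H) :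
    ∫ s, charIntegral H s 1 ^ 2 ≤ ∫ z, H z ^ 2 ∂stripMeasure := by
  rw [integral_prod _ h.memLp.integrable_sq]
  refine integral_mono_ae h.memLp_total.integrable_sq h.memLp.integrable_sq.integral_prod_left ?_
  filter_upwards [h.ae_slice] with s hs
  exact sq_charIntegral_le (right_mem_Icc.mpr zero_le_one) hs

/-- A characteristic `t = s + x` with `0 < x < 1` meets the time interval `(0,T)` only if `-1 < s <
T`. -/
lemma IsCharSource.charIntegral_eq_zero (h : IsCharSource T H) {s x : ℝ} (hx : x ∈ Icc (0 : ℝ) 1)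
    (hs : s ∉ Ioo (-1) T) : charIntegral H s x = 0 := by
  rw [charIntegral_of_mem hx.1]
  refine setIntegral_eq_zero_of_forall_eq_zero fun y hy => h.supp s y ⟨hy.1, hy.2.trans_le hx.2⟩ ?_
  intro hm
  exact hs ⟨by linarith [hm.1, hy.2, hx.2], by linarith [hm.2, hy.1]⟩

variable {ρ₀ p : ℝ → ℝ}

/-- The point `x` at time `0` lies on the characteristic `s = -x`, so initial data act as inflow
during the fictitious times `(-1,0)`. -/
lemma memLp_comp_neg (hρ : MemL2Space ρ₀) :
    MemLp ((Ioo (-1 : ℝ) 0).indicator fun s => ρ₀ (-s)) 2 volume ∧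
    ∫ s, ((Ioo (-1 : ℝ) 0).indicator (fun s => ρ₀ (-s)) s) ^ 2 = ∫ x in Ioo (0 : ℝ) 1, ρ₀ x ^ 2 := by
  have L : MemLp ((Ioo (0 : ℝ) 1).indicator ρ₀) 2 volume :=
    (memLp_indicator_iff_restrict measurableSet_Ioo).mpr hρ
  have e : ∀ s, (Ioo (-1 : ℝ) 0).indicator (fun s => ρ₀ (-s)) s =
      (Ioo (0 : ℝ) 1).indicator ρ₀ (-s) := fun s => by
    have : s ∈ Ioo (-1 : ℝ) 0 ↔ -s ∈ Ioo (0:ℝ) 1 := by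
      constructor <;> intro h <;> constructor <;> linarith [h.1, h.2]
    by_cases hs : s ∈ Ioo (-1 : ℝ) 0
    · rw [indicator_of_mem hs, indicator_of_mem (this.mp hs)]
    · rw [indicator_of_notMem hs, indicator_of_notMem (fun h => hs (this.mpr h))]
  constructor
  · have : (Ioo (-1 : ℝ) 0).indicator (fun s => ρ₀ (-s)) =
        (Ioo (0 : ℝ) 1).indicator ρ₀ ∘ Neg.neg := funext e
    rw [this]
    exact L.comp_measurePreserving (Measure.measurePreserving_neg volume)
  · simp_rw [e]
    rw [integral_neg_eq_self (fun s => (Ioo (0 : ℝ) 1).indicator ρ₀ s ^ 2) volume,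
      ← integral_indicator measurableSet_Ioo]
    congr 1; ext s
    by_cases hs : s ∈ Ioo (0 : ℝ) 1 <;> simp [hs]

lemma MemLp.comp_sub_const {f : ℝ → ℝ} (hf : MemLp f 2 volume) (a : ℝ) :
    MemLp (fun s => f (s - a)) 2 volume :=
  hf.comp_measurePreserving (measurePreserving_sub_right volume a)

lemma memLp_inflowData (h : IsCharSource T H) (hρ : MemL2Space ρ₀) (hp : MemL2Time T p) :
    MemLp (inflowData T ρ₀ p H) 2 volume :=
  ((memLp_comp_neg hρ).1.add ((memLp_indicator_iff_restrict measurableSet_Ioo).mpr hp)).add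
    (MemLp.comp_sub_const h.memLp_total 1)

lemma memLp_inflow (h : IsCharSource T H) (hρ : MemL2Space ρ₀) (hp : MemL2Time T p) (N : ℕ) :
    MemLp (inflow T ρ₀ p H N) 2 volume :=
  memLp_finsetSum (f := fun (j : ℕ) s => inflowData T ρ₀ p H (s - j)) _ fun j _ =>
    MemLp.comp_sub_const (memLp_inflowData h hρ hp) j

lemma memLp_outflow (h : IsCharSource T H) (hρ : MemL2Space ρ₀) (hp : MemL2Time T p) (N : ℕ) :
    MemLp (outflow T ρ₀ p H N) 2 volume :=
  (MemLp.comp_sub_const (memLp_inflow h hρ hp N) 1).add (MemLp.comp_sub_const h.memLp_total 1)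

lemma integral_sq_inflowData_le (h : IsCharSource T H) (hρ : MemL2Space ρ₀) (hp : MemL2Time T p) :
    ∫ s, inflowData T ρ₀ p H s ^ 2 ≤ 3 * ((∫ x in Ioo (0 : ℝ) 1, ρ₀ x ^ 2)
      + (∫ t in Ioo (0 : ℝ) T, p t ^ 2) + ∫ z, H z ^ 2 ∂stripMeasure) := by
  have L1 := (memLp_comp_neg hρ).1
  have L2 : MemLp ((Ioo (0 : ℝ) T).indicator p) 2 volume :=
    (memLp_indicator_iff_restrict measurableSet_Ioo).mpr hp
  have L3 := MemLp.comp_sub_const h.memLp_total 1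
  have e2 : ∫ s, (Ioo (0 : ℝ) T).indicator p s ^ 2 = ∫ t in Ioo (0 : ℝ) T, p t ^ 2 := by
    rw [← integral_indicator measurableSet_Ioo]
    congr 1; ext s
    by_cases hs : s ∈ Ioo (0 : ℝ) T <;> simp [hs]
  have e3 : ∫ s, charIntegral H (s - 1) 1 ^ 2 = ∫ s, charIntegral H s 1 ^ 2 :=
    integral_sub_right_eq_self (fun s => charIntegral H s 1 ^ 2) 1
  have bound : ∫ s, inflowData T ρ₀ p H s ^ 2 ≤
      ∫ s, 3 * (((Ioo (-1 : ℝ) 0).indicator (fun s => ρ₀ (-s)) s) ^ 2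
        + (Ioo (0 : ℝ) T).indicator p s ^ 2 + charIntegral H (s - 1) 1 ^ 2) := by
    refine integral_mono (memLp_inflowData h hρ hp).integrable_sq
      (((L1.integrable_sq.add L2.integrable_sq).add L3.integrable_sq).const_mul 3) fun s => ?_
    simp only [inflowData]
    set a := (Ioo (-1 : ℝ) 0).indicator (fun s => ρ₀ (-s)) s
    set b := (Ioo (0 : ℝ) T).indicator p s
    set c := charIntegral H (s - 1) 1
    nlinarith [sq_nonneg (a - b), sq_nonneg (a - c), sq_nonneg (b - c)]
  refine bound.trans ?_
  have i12 : Integrable (fun s => ((Ioo (-1 : ℝ) 0).indicator (fun s => ρ₀ (-s)) s) ^ 2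
        + (Ioo (0 : ℝ) T).indicator p s ^ 2) := L1.integrable_sq.add L2.integrable_sq
  rw [integral_const_mul, integral_add i12 L3.integrable_sq,
    integral_add L1.integrable_sq L2.integrable_sq, (memLp_comp_neg hρ).2, e2, e3]
  linarith [h.integral_sq_total_le]

/-- The boundary value at `x = 1` is bounded by the data and the source. -/
lemma integral_sq_outflow_le (h : IsCharSource T H) (hρ : MemL2Space ρ₀) (hp : MemL2Time T p)
    (N : ℕ) :
    ∫ s, outflow T ρ₀ p H N s ^ 2 ≤ 8 * ((N : ℝ) + 1) ^ 2 * ((∫ x in Ioo (0 : ℝ) 1, ρ₀ x ^ 2)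
      + (∫ t in Ioo (0 : ℝ) T, p t ^ 2) + ∫ z, H z ^ 2 ∂stripMeasure) := by
  have Lb := memLp_inflowData h hρ hp
  have Lq := memLp_inflow h hρ hp N
  have b1 : ∫ s, inflow T ρ₀ p H N s ^ 2 ≤
      ((N : ℝ) + 1) ^ 2 * ∫ s, inflowData T ρ₀ p H s ^ 2 := by
    have ij : ∀ j ∈ Finset.range (N + 1),
        Integrable (fun s => inflowData T ρ₀ p H (s - (j : ℕ)) ^ 2) volume :=
      fun j _ => (MemLp.comp_sub_const Lb j).integrable_sq
    calc ∫ s, inflow T ρ₀ p H N s ^ 2 ≤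
        ∫ s, ((N : ℝ) + 1) * ∑ j ∈ Finset.range (N + 1), inflowData T ρ₀ p H (s - (j : ℕ)) ^ 2 := by
          refine integral_mono Lq.integrable_sq ((integrable_finsetSum _ ij).const_mul _)
            fun s => ?_
          have := sq_sum_le_card_mul_sum_sq (s := Finset.range (N + 1))
            (f := fun j : ℕ => inflowData T ρ₀ p H (s - j))
          simpa [inflow] using this
      _ = _ := by
          rw [integral_const_mul, integral_finsetSum _ ij]
          have : ∀ j ∈ Finset.range (N + 1), ∫ s, inflowData T ρ₀ p H (s - (j : ℕ)) ^ 2 =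
              ∫ s, inflowData T ρ₀ p H s ^ 2 := fun j _ =>
            integral_sub_right_eq_self (fun s => inflowData T ρ₀ p H s ^ 2) (j : ℝ)
          rw [Finset.sum_congr rfl this]
          simp only [Finset.sum_const, Finset.card_range, nsmul_eq_mul]
          push_cast; ring
  have b2 : ∫ s, outflow T ρ₀ p H N s ^ 2 ≤
      2 * (∫ s, inflow T ρ₀ p H N s ^ 2) + 2 * ∫ s, charIntegral H s 1 ^ 2 := by
    rw [← integral_sub_right_eq_self (fun s => inflow T ρ₀ p H N s ^ 2) (1:ℝ),
      ← integral_sub_right_eq_self (fun s => charIntegral H s 1 ^ 2) (1:ℝ), ← integral_const_mul,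
      ← integral_const_mul, ← integral_add ((MemLp.comp_sub_const Lq 1).integrable_sq.const_mul 2)
        ((MemLp.comp_sub_const h.memLp_total 1).integrable_sq.const_mul 2)]
    refine integral_mono (memLp_outflow h hρ hp N).integrable_sq
      (((MemLp.comp_sub_const Lq 1).integrable_sq.const_mul 2).add
        ((MemLp.comp_sub_const h.memLp_total 1).integrable_sq.const_mul 2)) fun s => ?_
    simp only [outflow]
    nlinarith [sq_nonneg (inflow T ρ₀ p H N (s - 1) - charIntegral H (s - 1) 1)]
  have b3 := integral_sq_inflowData_le h hρ hp
  have b4 := h.integral_sq_total_le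
  have n1 : 0 ≤ ∫ x in Ioo (0 : ℝ) 1, ρ₀ x ^ 2 := integral_nonneg fun _ => sq_nonneg _
  have n2 : 0 ≤ ∫ t in Ioo (0 : ℝ) T, p t ^ 2 := integral_nonneg fun _ => sq_nonneg _
  have n3 : 0 ≤ ∫ z, H z ^ 2 ∂stripMeasure := integral_nonneg fun _ => sq_nonneg _
  -- The constant: the bounds above give `2 · 3 (N+1)² + 2`, at most `8 (N+1)²`.
  have hN : 1 ≤ ((N : ℝ) + 1) ^ 2 := one_le_pow₀ (by linarith [Nat.cast_nonneg (α := ℝ) N])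
  nlinarith [mul_le_mul_of_nonneg_left b3 (by positivity : 0 ≤ ((N : ℝ) + 1) ^ 2)]

lemma inflowData_eq_zero (h : IsCharSource T H) {s : ℝ} (hs : s ≤ -1) :
    inflowData T ρ₀ p H s = 0 := by
  rw [inflowData, indicator_of_notMem (fun h => by linarith [h.1]),
    indicator_of_notMem (fun h => by linarith [h.1]),
    h.charIntegral_eq_zero (right_mem_Icc.mpr zero_le_one) (fun h => by linarith [h.1])]
  simp

lemma inflow_eq_zero (h : IsCharSource T H) {N : ℕ} {s : ℝ} (hs : s ≤ -1) :
    inflow T ρ₀ p H N s = 0 :=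
  Finset.sum_eq_zero fun j _ =>
    inflowData_eq_zero h (by linarith [Nat.cast_nonneg (α := ℝ) j])

/-- The truncated sum satisfies the exact recursion, because the term lost by the truncation is
evaluated at `s - 1 - N ≤ -1`, before anything has entered. -/
lemma inflow_eq_add (h : IsCharSource T H) {N : ℕ} {s : ℝ} (hs : s ≤ N) :
    inflow T ρ₀ p H N s = inflowData T ρ₀ p H s + inflow T ρ₀ p H N (s - 1) := by
  have last : inflowData T ρ₀ p H (s - 1 - N) = 0 := inflowData_eq_zero h (by linarith)
  rw [inflow, inflow, Finset.sum_range_succ', Finset.sum_range_succ, last, add_zero]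
  rw [add_comm]
  congr 1
  · simp
  · refine Finset.sum_congr rfl fun j _ => ?_
    congr 1; push_cast; ring

lemma inflow_eq_initial (h : IsCharSource T H) {N : ℕ} {s : ℝ} (hs : s ∈ Ioo (-1) 0) :
    inflow T ρ₀ p H N s = ρ₀ (-s) := by
  rw [inflow_eq_add h (by linarith [hs.2, Nat.cast_nonneg (α := ℝ) N]),
    inflow_eq_zero h (by linarith [hs.2]), inflowData, indicator_of_mem hs,
    indicator_of_notMem (fun h => by linarith [h.1, hs.2]),
    h.charIntegral_eq_zero (right_mem_Icc.mpr zero_le_one) (fun h => by linarith [h.1, hs.2])]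
  simp

/-- This is the boundary condition `ρ(t,0) = ρ(t,1) + p(t)`; `N ≥ T` ensures that all turns begun
before `T` are counted. -/
lemma inflow_eq_outflow (h : IsCharSource T H) {N : ℕ} (hN : T ≤ N) {s : ℝ}
    (hs : s ∈ Ioo 0 T) : inflow T ρ₀ p H N s = outflow T ρ₀ p H N s + p s := by
  rw [inflow_eq_add h (hs.2.le.trans hN), inflowData, outflow, indicator_of_mem hs,
    indicator_of_notMem (fun h => by linarith [h.2, hs.1])]
  ring

end Source

/-! ### Explicit solutions of the backward transport problem. -/

lemma hasDerivAt_parametric_integral {g g' : ℝ → ℝ → ℝ} (hg : ∀ y, Continuous (g y))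
    (hg' : Continuous (Function.uncurry g'))
    (hd : ∀ y r, HasDerivAt (fun y => g y r) (g' y r) y) (y : ℝ) :
    HasDerivAt (fun y => ∫ r in (0 : ℝ)..1, g y r) (∫ r in (0 : ℝ)..1, g' y r) y := by
  obtain ⟨M, hM⟩ := ((isCompact_Icc (a := y - 1) (b := y + 1)).prod
    (isCompact_Icc (a := (0:ℝ)) (b := 1))).exists_bound_of_continuousOn hg'.continuousOn
  refine (intervalIntegral.hasDerivAt_integral_of_dominated_loc_of_deriv_le
    (s := Icc (y - 1) (y + 1)) (bound := fun _ => M) (Icc_mem_nhds (by linarith) (by linarith))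
    (Eventually.of_forall fun z => (hg z).aestronglyMeasurable) ((hg y).intervalIntegrable _ _)
    (hg'.uncurry_left y).aestronglyMeasurable ?_ intervalIntegrable_const ?_).2
  · refine ae_of_all _ fun r hr z hz => ?_
    rw [uIoc_of_le zero_le_one] at hr
    exact hM (z, r) ⟨hz, Ioc_subset_Icc_self hr⟩
  · exact ae_of_all _ fun r _ z _ => hd z r

/-- A function in characteristic coordinates. -/
def shear (F : ℝ × ℝ → ℝ) (q : ℝ × ℝ) : ℝ := F (q.1 + q.2, q.2)

/-- The sum of the integrals of `F` over the characteristics that pass through `(s, 0)`. -/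
noncomputable def returnSum (F : ℝ × ℝ → ℝ) (N : ℕ) (s : ℝ) : ℝ :=
  ∑ j ∈ Finset.range (N + 1), charIntegral (shear F) (s + j) 1

/-- The solution of the backward periodic transport equation with source `F`. -/
noncomputable def backwardTest (F : ℝ × ℝ → ℝ) (N : ℕ) (t x : ℝ) : ℝ :=
  charIntegral (shear F) (t - x) 1 + returnSum F N (t - x + 1)
    - ∫ r in (0 : ℝ)..1, F (t - r, x - r)

section Test

variable {T : ℝ} {F : ℝ × ℝ → ℝ}

lemma isCharSource_shear (hF : Continuous F) (hc : HasCompactSupport F)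
    (h0 : ∀ z, z ∉ Ioo 0 T ×ˢ Ioo (0 : ℝ) 1 → F z = 0) : IsCharSource T (shear F) where
  meas := by
    unfold shear
    exact (hF.comp (by fun_prop)).stronglyMeasurable
  memLp := by
    have m : MeasurePreserving (fun z : ℝ × ℝ => (z.1 + z.2, z.2)) stripMeasure stripMeasure :=
      measurePreserving_add_prod _ _
    have e : stripMeasure ≤ (volume : Measure (ℝ × ℝ)) := by
      rw [Measure.volume_eq_prod]
      exact Measure.prod_mono le_rfl Measure.restrict_le_self
    exact ((hF.memLp_of_hasCompactSupport hc).mono_measure e).comp_measurePreserving m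
  supp := fun s x _ hs => h0 _ fun h => hs h.1

/-- Since `F` vanishes for nonpositive abscissae, a diagonal integral of fixed length `1` equals the
one stopping at `x = 0`. The fixed length makes `backwardTest` differentiable on the whole plane,
under the integral sign. -/
lemma diag_integral_eq (h0 : ∀ z, z ∉ Ioo 0 T ×ˢ Ioo (0 : ℝ) 1 → F z = 0) (hF : Continuous F)
    {s x : ℝ} (hx : x ∈ Icc (0 : ℝ) 1) :
    ∫ r in (0 : ℝ)..1, F (s + x - r, x - r) = charIntegral (shear F) s x := by
  have e1 : ∫ r in (0 : ℝ)..1, F (s + x - r, x - r) = ∫ z in (x - 1)..x, shear F (s, z) := by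
    have := intervalIntegral.integral_comp_sub_left (fun z => shear F (s, z)) (a := 0) (b := 1) x
    rw [sub_zero] at this
    rw [← this]
    congr 1; ext r
    simp only [shear]; congr 2; ring
  have c : Continuous fun z => shear F (s, z) := by unfold shear; fun_prop
  have e2 : ∫ z in (x - 1)..0, shear F (s, z) = 0 := by
    rw [intervalIntegral.integral_symm, neg_eq_zero]
    refine intervalIntegral.integral_zero_ae (ae_of_all _ fun z hz => h0 _ fun h => ?_)
    rw [uIoc_comm, uIoc_of_le (by linarith [hx.2])] at hz
    exact absurd h.2.1 (not_lt.mpr hz.2)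
  rw [e1, charIntegral, ← intervalIntegral.integral_add_adjacent_intervals
    (c.intervalIntegrable (x - 1) 0) (c.intervalIntegrable 0 x), e2, zero_add]

/-- The value on the characteristic `s` is what `F` still contributes: the rest of the present turn,
from `x` to `1`, and all later turns. -/
lemma backwardTest_char (h0 : ∀ z, z ∉ Ioo 0 T ×ˢ Ioo (0 : ℝ) 1 → F z = 0) (hF : Continuous F)
    (N : ℕ) {s x : ℝ} (hx : x ∈ Icc (0 : ℝ) 1) :
    backwardTest F N (s + x) x =
      charIntegral (shear F) s 1 + returnSum F N (s + 1) - charIntegral (shear F) s x := by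
  rw [backwardTest, diag_integral_eq h0 hF hx, add_sub_cancel_right]

lemma backwardTest_one (h0 : ∀ z, z ∉ Ioo 0 T ×ˢ Ioo (0 : ℝ) 1 → F z = 0) (hF : Continuous F)
    (N : ℕ) (t : ℝ) : backwardTest F N t 1 = returnSum F N t := by
  have := backwardTest_char h0 hF N (s := t - 1) (right_mem_Icc.mpr zero_le_one)
  rw [sub_add_cancel] at this
  rw [this]; ring

/-- Shifting the index adds only the term at `s + 1 + N ≥ T`, whose characteristic misses the
support. -/
lemma returnSum_shift (h : IsCharSource T (shear F)) {N : ℕ} {s : ℝ} (hs : T ≤ s + (N + 1)) :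
    charIntegral (shear F) s 1 + returnSum F N (s + 1) = returnSum F N s := by
  have last : charIntegral (shear F) (s + 1 + N) 1 = 0 :=
    h.charIntegral_eq_zero (right_mem_Icc.mpr zero_le_one) fun hm => by linarith [hm.2]
  rw [returnSum, returnSum, Finset.sum_range_succ, Finset.sum_range_succ' _ N, last, add_zero,
    add_comm]
  congr 1
  · refine Finset.sum_congr rfl fun j _ => ?_
    congr 1; push_cast; ring
  · simp

/-- At `t = 0` the diagonal integral runs through nonpositive times, where `F` vanishes. The shift
is applied at `s = -x ≥ -1`, which is why `returnSum` has `N + 1` terms with `N ≥ T`. -/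
lemma backwardTest_initial (h0 : ∀ z, z ∉ Ioo 0 T ×ˢ Ioo (0 : ℝ) 1 → F z = 0)
    (h : IsCharSource T (shear F)) {N : ℕ} (hN : T ≤ N)
    {x : ℝ} (hx : x ∈ Icc (0 : ℝ) 1) : backwardTest F N 0 x = returnSum F N (-x) := by
  rw [backwardTest, zero_sub, returnSum_shift h (by linarith [hx.2]), sub_eq_self]
  refine intervalIntegral.integral_zero_ae (ae_of_all _ fun r hr => h0 _ fun hm => ?_)
  rw [uIoc_of_le zero_le_one] at hr
  linarith [hr.1, hm.1.1]

lemma returnSum_eq_zero (h : IsCharSource T (shear F)) {N : ℕ} {s : ℝ} (hs : T ≤ s) :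
    returnSum F N s = 0 :=
  Finset.sum_eq_zero fun j _ => h.charIntegral_eq_zero (right_mem_Icc.mpr zero_le_one)
    fun hm => by linarith [hm.2, Nat.cast_nonneg (α := ℝ) j]

/-- The part depending on `t - x` is annihilated by `∂ₜ + ∂ₓ`. On the diagonal integral this
operator gives `F(t,x) - F(t-1,x-1)`, and the last value is zero for `x < 1`. Periodicity is
`returnSum_shift`; at time `T` nothing of the source remains ahead. -/
lemma exists_isTransportTest (hF : ContDiff ℝ 1 F) (hc : HasCompactSupport F)
    (h0 : ∀ z, z ∉ Ioo 0 T ×ˢ Ioo (0 : ℝ) 1 → F z = 0) {N : ℕ} (hN : T ≤ N) :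
    ∃ σt σx : ℝ → ℝ → ℝ, IsTransportTest T (backwardTest F N) σt σx ∧
      ∀ t, ∀ x ∈ Ioo (0 : ℝ) 1, σt t x + σx t x = -F (t, x) := by
  have cF := hF.continuous
  have hs := isCharSource_shear cF hc h0
  set Ft : ℝ × ℝ → ℝ := fun z => fderiv ℝ F z (1, 0) with hFt
  set Fx : ℝ × ℝ → ℝ := fun z => fderiv ℝ F z (0, 1) with hFx
  have cFt : Continuous Ft := (hF.continuous_fderiv (by norm_num)).clm_apply continuous_const
  have cFx : Continuous Fx := (hF.continuous_fderiv (by norm_num)).clm_apply continuous_const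
  have dF : ∀ z, HasFDerivAt F (fderiv ℝ F z) z := fun z =>
    (hF.differentiable (by norm_num) z).hasFDerivAt
  have dt : ∀ t x, HasDerivAt (fun s => F (s, x)) (Ft (t, x)) t := fun t x =>
    (dF (t, x)).comp_hasDerivAt t ((hasDerivAt_id t).prodMk (hasDerivAt_const t x))
  have dx : ∀ t x, HasDerivAt (fun y => F (t, y)) (Fx (t, x)) x := fun t x =>
    (dF (t, x)).comp_hasDerivAt x ((hasDerivAt_const x t).prodMk (hasDerivAt_id x))
  have ddiag : ∀ t x r, HasDerivAt (fun r => F (t - r, x - r))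
      (-(Ft (t - r, x - r) + Fx (t - r, x - r))) r := fun t x r => by
    have := (dF (t - r, x - r)).comp_hasDerivAt r
      (((hasDerivAt_id r).const_sub t).prodMk ((hasDerivAt_id r).const_sub x))
    refine this.congr_deriv ?_
    have e : ((-1 : ℝ), (-1 : ℝ)) = -((1, 0) + (0, 1)) := by simp
    rw [e, map_neg, map_add]
  -- the source sums and their derivatives
  set Γ : ℝ → ℝ := fun s => ∫ z in (0 : ℝ)..1, F (s + z, z) with hΓ
  set Γ' : ℝ → ℝ := fun s => ∫ z in (0 : ℝ)..1, Ft (s + z, z) with hΓ'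
  have dΓ : ∀ s, HasDerivAt Γ (Γ' s) s := hasDerivAt_parametric_integral
    (g := fun s z => F (s + z, z)) (g' := fun s z => Ft (s + z, z)) (fun s => by fun_prop)
    (by simp only [Function.uncurry_def]; fun_prop) (fun s z => (dt (s + z) z).comp_add_const s z)
  have cΓ' : Continuous Γ' :=
    intervalIntegral.continuous_parametric_intervalIntegral_of_continuous'
      (f := fun s z => Ft (s + z, z)) (by simp only [Function.uncurry_def]; fun_prop) _ _
  set R : ℝ → ℝ := fun s => Γ s + ∑ j ∈ Finset.range (N + 1), Γ (s + 1 + j) with hR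
  set R' : ℝ → ℝ := fun s => Γ' s + ∑ j ∈ Finset.range (N + 1), Γ' (s + 1 + j) with hR'
  have dR : ∀ s, HasDerivAt R (R' s) s := fun s => by
    refine (dΓ s).add (HasDerivAt.fun_sum fun j _ => ?_)
    have := (dΓ (s + (1 + j))).comp_add_const s (1 + j)
    simpa only [add_assoc] using this
  have cR' : Continuous R' := by
    refine cΓ'.add (continuous_finsetSum _ fun j _ => ?_)
    fun_prop
  have cR : Continuous R := continuous_iff_continuousAt.mpr fun s => (dR s).continuousAt
  set Jt : ℝ → ℝ → ℝ := fun t x => ∫ r in (0 : ℝ)..1, Ft (t - r, x - r) with hJt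
  set Jx : ℝ → ℝ → ℝ := fun t x => ∫ r in (0 : ℝ)..1, Fx (t - r, x - r) with hJx
  have cJ : ∀ {G : ℝ × ℝ → ℝ}, Continuous G →
      Continuous (Function.uncurry fun t x => ∫ r in (0 : ℝ)..1, G (t - r, x - r)) := by
    intro G hG
    exact intervalIntegral.continuous_parametric_intervalIntegral_of_continuous'
      (f := fun (q : ℝ × ℝ) r => G (q.1 - r, q.2 - r))
      (by simp only [Function.uncurry_def]; fun_prop) _ _
  have eσ : backwardTest F N = fun t x => R (t - x) - ∫ r in (0 : ℝ)..1, F (t - r, x - r) := by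
    ext t x
    simp only [backwardTest, hR, returnSum, charIntegral, shear, hΓ]
  refine ⟨fun t x => R' (t - x) - Jt t x, fun t x => -R' (t - x) - Jx t x, ?_, ?_⟩
  · constructor
    · rw [eσ]
      exact (cR.comp (by fun_prop : Continuous fun q : ℝ × ℝ => q.1 - q.2)).sub (cJ cF)
    · exact (cR'.comp (by fun_prop : Continuous fun q : ℝ × ℝ => q.1 - q.2)).sub (cJ cFt)
    · exact (cR'.comp (by fun_prop : Continuous fun q : ℝ × ℝ => q.1 - q.2)).neg.sub (cJ cFx)
    · intro t x
      rw [eσ]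
      refine ((dR (t - x)).comp_sub_const t x).sub ?_
      exact hasDerivAt_parametric_integral (g := fun s r => F (s - r, x - r))
        (g' := fun s r => Ft (s - r, x - r)) (fun s => by fun_prop)
        (by simp only [Function.uncurry_def]; fun_prop)
        (fun s r => (dt (s - r) (x - r)).comp_sub_const s r) t
    · intro t x
      rw [eσ]
      refine ((dR (t - x)).comp_const_sub t x).sub ?_
      exact hasDerivAt_parametric_integral (g := fun y r => F (t - r, y - r))
        (g' := fun y r => Fx (t - r, y - r)) (fun s => by fun_prop)
        (by simp only [Function.uncurry_def]; fun_prop)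
        (fun y r => (dx (t - r) (y - r)).comp_sub_const y r) x
    · intro t ht
      have h1 := backwardTest_char h0 cF N (s := t) (left_mem_Icc.mpr zero_le_one)
      rw [add_zero] at h1
      rw [h1, backwardTest_one h0 cF, returnSum_shift hs (by linarith [ht.1])]
      simp [charIntegral]
    · intro x hx
      have h1 := backwardTest_char h0 cF N (s := T - x) hx
      rw [sub_add_cancel] at h1
      rw [h1, returnSum_eq_zero hs (by linarith [hx.2]), add_zero, sub_eq_zero]
      have c : Continuous fun z => shear F (T - x, z) := by unfold shear; fun_prop
      rw [charIntegral, charIntegral, ← intervalIntegral.integral_add_adjacent_intervals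
        (c.intervalIntegrable 0 x) (c.intervalIntegrable x 1), add_eq_left]
      refine intervalIntegral.integral_zero_ae (ae_of_all _ fun z hz => h0 _ fun hm => ?_)
      rw [uIoc_of_le hx.2] at hz
      have := hm.1.2
      simp only at this
      linarith [hz.1]
  · intro t x hx
    have ftc := intervalIntegral.integral_eq_sub_of_hasDerivAt (a := 0) (b := 1)
      (fun r _ => ddiag t x r) (Continuous.intervalIntegrable (by fun_prop) _ _)
    rw [intervalIntegral.integral_neg, intervalIntegral.integral_add
      (Continuous.intervalIntegrable (by fun_prop) _ _)
      (Continuous.intervalIntegrable (by fun_prop) _ _),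
      h0 (t - 1, x - 1) (fun hm => by linarith [hm.2.1, hx.2]), sub_zero, sub_zero] at ftc
    change -(Jt t x + Jx t x) = _ at ftc
    linarith
end Test

/-! ### Duality: `ρ` is given by its characteristics. -/

lemma cylMeasure_eq_restrict (T : ℝ) :
    cylMeasure T = stripMeasure.restrict (Ioo (0 : ℝ) T ×ˢ univ) := by
  rw [cylMeasure, stripMeasure, ← Measure.prod_restrict, Measure.restrict_univ]

lemma integral_strip_shear {T : ℝ} {G : ℝ × ℝ → ℝ} (hG : ∀ z : ℝ × ℝ, z.1 ∉ Ioo 0 T → G z = 0) :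
    ∫ z, shear G z ∂stripMeasure = ∫ z, G z ∂(cylMeasure T) := by
  have m : MeasurePreserving (fun z : ℝ × ℝ => (z.1 + z.2, z.2)) stripMeasure stripMeasure :=
    measurePreserving_add_prod _ _
  have me : MeasurableEmbedding (fun z : ℝ × ℝ => (z.1 + z.2, z.2)) := by
    refine Continuous.measurableEmbedding (by fun_prop) fun a b hab => ?_
    simp only [Prod.mk.injEq] at hab
    ext <;> linarith [hab.1, hab.2]
  rw [cylMeasure_eq_restrict, setIntegral_eq_integral_of_forall_compl_eq_zero]
  · exact m.integral_comp me G
  · exact fun z hz => hG z fun h => hz ⟨h, mem_univ _⟩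

/-- Integration along individual characteristics requires a genuinely measurable function on the
whole strip: a representative of `-d`, extended by zero in time. -/
lemma MemL2Q.exists_source {T : ℝ} {d : ℝ → ℝ → ℝ} (hd : MemL2Q T d) :
    ∃ h : ℝ × ℝ → ℝ, IsCharSource T (shear h) ∧ (∀ z : ℝ × ℝ, z.1 ∉ Ioo 0 T → h z = 0) ∧
      ∀ᵐ z ∂(cylMeasure T), h z = -d z.1 z.2 := by
  have L := memL2Q_iff.mp hd
  set g := L.1.mk (Function.uncurry d) with hg
  have mS : MeasurableSet (Ioo (0 : ℝ) T ×ˢ (univ : Set ℝ)) := measurableSet_Ioo.prod .univ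
  set h : ℝ × ℝ → ℝ := (Ioo (0 : ℝ) T ×ˢ univ).indicator (fun z => -g z) with hh
  have mh : StronglyMeasurable h := L.1.stronglyMeasurable_mk.neg.indicator mS
  have m : MeasurePreserving (fun z : ℝ × ℝ => (z.1 + z.2, z.2)) stripMeasure stripMeasure :=
    measurePreserving_add_prod _ _
  have Lg : MemLp g 2 (stripMeasure.restrict (Ioo (0 : ℝ) T ×ˢ univ)) := by
    rw [← cylMeasure_eq_restrict]; exact (memLp_congr_ae L.1.ae_eq_mk).mp L
  have Lh : MemLp h 2 stripMeasure := (memLp_indicator_iff_restrict mS).mpr Lg.neg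
  have off : ∀ z : ℝ × ℝ, z.1 ∉ Ioo 0 T → h z = 0 := fun z hz =>
    indicator_of_notMem (fun hm => hz hm.1) _
  refine ⟨h, ⟨mh.comp_measurable m.measurable, Lh.comp_measurePreserving m,
    fun s x _ hs => off _ hs⟩, off, ?_⟩
  filter_upwards [L.1.ae_eq_mk, ae_cyl_mem T] with z hz hm
  rw [hh, indicator_of_mem (show z ∈ Ioo (0 : ℝ) T ×ˢ univ from ⟨hm.1, mem_univ _⟩), hg, ← hz]
  rfl

section Duality

variable {T : ℝ} {H F : ℝ × ℝ → ℝ} {ρ₀ p : ℝ → ℝ}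

lemma memLp_returnSum (hS : IsCharSource T (shear F)) (N : ℕ) :
    MemLp (returnSum F N) 2 volume := by
  refine memLp_finsetSum (f := fun (j : ℕ) s => charIntegral (shear F) (s + j) 1) _ fun j _ => ?_
  have := MemLp.comp_sub_const hS.memLp_total (-j)
  simpa only [sub_neg_eq_add] using this

/-- Summation over past turns and summation over future turns are adjoint: translating each term
moves the shifts from the inflow data to the source integrals. -/
lemma integral_inflow_mul (h : IsCharSource T H) (hS : IsCharSource T (shear F))
    (hρ : MemL2Space ρ₀) (hp : MemL2Time T p) (N : ℕ) :
    ∫ s, inflow T ρ₀ p H N s * charIntegral (shear F) s 1 =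
      (∫ x in Ioo (0 : ℝ) 1, ρ₀ x * returnSum F N (-x)) +
      (∫ t in Ioo (0 : ℝ) T, p t * returnSum F N t) +
      ∫ s, charIntegral H s 1 * returnSum F N (s + 1) := by
  have Lb := memLp_inflowData h hρ hp
  have LΓ := hS.memLp_total
  have LP := memLp_returnSum hS N
  have step1 : ∫ s, inflow T ρ₀ p H N s * charIntegral (shear F) s 1 =
      ∫ s, inflowData T ρ₀ p H s * returnSum F N s := by
    simp only [inflow, returnSum, Finset.sum_mul, Finset.mul_sum]
    rw [integral_finsetSum _ fun j _ => integrable_mul_two (MemLp.comp_sub_const Lb (j : ℕ)) LΓ,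
      integral_finsetSum _ fun j _ => integrable_mul_two Lb (by
        have := MemLp.comp_sub_const LΓ (-(j : ℕ))
        simpa only [sub_neg_eq_add] using this)]
    refine Finset.sum_congr rfl fun j _ => ?_
    rw [← integral_add_right_eq_self (fun s => inflowData T ρ₀ p H (s - (j : ℕ)) * _) (j : ℝ)]
    simp only [add_sub_cancel_right]
  have L1 := (memLp_comp_neg hρ).1
  have L2 : MemLp ((Ioo (0 : ℝ) T).indicator p) 2 volume :=
    (memLp_indicator_iff_restrict measurableSet_Ioo).mpr hp
  have L3 := MemLp.comp_sub_const h.memLp_total 1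
  have i12 : Integrable (fun s => (Ioo (-1 : ℝ) 0).indicator (fun s => ρ₀ (-s)) s * returnSum F N s
      + (Ioo (0 : ℝ) T).indicator p s * returnSum F N s) :=
    (integrable_mul_two L1 LP).add (integrable_mul_two L2 LP)
  rw [step1]
  simp only [inflowData, add_mul]
  rw [integral_add i12 (integrable_mul_two L3 LP), integral_add (integrable_mul_two L1 LP)
    (integrable_mul_two L2 LP)]
  congr 1
  · congr 1
    · rw [← integral_neg_eq_self, ← integral_indicator measurableSet_Ioo]
      congr 1; ext x
      by_cases hx : x ∈ Ioo (0 : ℝ) 1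
      · rw [indicator_of_mem hx, indicator_of_mem (show -x ∈ Ioo (-1 : ℝ) 0 from
          ⟨by linarith [hx.2], by linarith [hx.1]⟩), neg_neg]
      · rw [indicator_of_notMem hx, indicator_of_notMem (fun hm => hx
          ⟨by linarith [hm.2], by linarith [hm.1]⟩), zero_mul]
    · rw [← integral_indicator measurableSet_Ioo]
      congr 1; ext x
      by_cases hx : x ∈ Ioo (0 : ℝ) T <;> simp [hx]
  · rw [← integral_sub_right_eq_self (fun s => charIntegral H s 1 * returnSum F N (s + 1)) (1:ℝ)]
    simp only [sub_add_cancel]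

/-- The solution given by the inflow and the source, in characteristic coordinates. -/
noncomputable def charSolution (T : ℝ) (ρ₀ p : ℝ → ℝ) (H : ℝ × ℝ → ℝ) (N : ℕ) (s x : ℝ) : ℝ :=
  inflow T ρ₀ p H N s + charIntegral H s x

lemma memLp_charSolution (h : IsCharSource T H) (hρ : MemL2Space ρ₀) (hp : MemL2Time T p)
    (N : ℕ) : MemLp (fun z : ℝ × ℝ => charSolution T ρ₀ p H N z.1 z.2) 2 stripMeasure :=
  ((memLp_inflow h hρ hp N).comp_fst _).add h.memLp_charIntegral

/-- This is the weak transport equation for the candidate. On each characteristic one integrates the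
product of the primitives of `H` and `shear F` by parts; the remaining boundary products are handled
by `integral_inflow_mul`. -/
lemma integral_charSolution_mul (h : IsCharSource T H) (hF : Continuous F)
    (hc : HasCompactSupport F) (h0 : ∀ z, z ∉ Ioo 0 T ×ˢ Ioo (0 : ℝ) 1 → F z = 0)
    (hρ : MemL2Space ρ₀) (hp : MemL2Time T p) (N : ℕ)
    (iσ : Integrable (fun z : ℝ × ℝ => H z * backwardTest F N (z.1 + z.2) z.2) stripMeasure) :
    ∫ z, charSolution T ρ₀ p H N z.1 z.2 * shear F z ∂stripMeasure =
      (∫ z, H z * backwardTest F N (z.1 + z.2) z.2 ∂stripMeasure) +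
      (∫ x in Ioo (0 : ℝ) 1, ρ₀ x * returnSum F N (-x)) +
      ∫ t in Ioo (0 : ℝ) T, p t * returnSum F N t := by
  have hS := isCharSource_shear hF hc h0
  have iW := integrable_mul_two (memLp_charSolution h hρ hp N) hS.memLp
  have LP1 : MemLp (fun s => returnSum F N (s + 1)) 2 volume := by
    simpa only [sub_neg_eq_add] using MemLp.comp_sub_const (memLp_returnSum hS N) (-1)
  have slice : ∀ᵐ s : ℝ, (∫ x in Ioo (0 : ℝ) 1, charSolution T ρ₀ p H N s x * shear F (s, x)) -
      (∫ x in Ioo (0 : ℝ) 1, H (s, x) * backwardTest F N (s + x) x) =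
      inflow T ρ₀ p H N s * charIntegral (shear F) s 1 -
        charIntegral H s 1 * returnSum F N (s + 1) := by
    filter_upwards [h.ae_slice] with s hs
    have iH : IntegrableOn (fun x => H (s, x)) (Ioo 0 1) := hs.integrable (by norm_num)
    have iH' : IntervalIntegrable (fun x => H (s, x)) volume 0 1 :=
      (intervalIntegrable_iff_integrableOn_Ioo_of_le zero_le_one).mpr iH
    have cS : Continuous fun x => shear F (s, x) := by unfold shear; fun_prop
    have cI : ContinuousOn (charIntegral H s) (Icc 0 1) := by
      have := intervalIntegral.continuousOn_primitive_interval' iH' (a := 0) (by simp)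
      rwa [uIcc_of_le zero_le_one] at this
    have cJ : Continuous (charIntegral (shear F) s) :=
      intervalIntegral.continuous_primitive (fun a b => cS.intervalIntegrable a b) 0
    have i1 : IntegrableOn (fun x => charIntegral H s x * shear F (s, x)) (Ioo 0 1) :=
      ((cI.mul cS.continuousOn).integrableOn_Icc).mono_set Ioo_subset_Icc_self
    have i2 : IntegrableOn (fun x => H (s, x) * charIntegral (shear F) s x) (Ioo 0 1) := by
      obtain ⟨M, hM⟩ := (isCompact_Icc (a := (0:ℝ)) (b := 1)).exists_bound_of_continuousOn
        cJ.continuousOn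
      refine Integrable.mul_bdd (c := M) iH cJ.aestronglyMeasurable ?_
      filter_upwards [ae_restrict_mem measurableSet_Ioo] with x hx
      exact hM x (Ioo_subset_Icc_self hx)
    have i3 : IntegrableOn (fun x => shear F (s, x)) (Ioo 0 1) :=
      (cS.continuousOn.integrableOn_Icc).mono_set Ioo_subset_Icc_self
    have parts := integral_primitive_mul_add (c₁ := 0) (c₂ := 0) iH' (cS.intervalIntegrable 0 1)
    simp only [zero_add, mul_zero, sub_zero] at parts
    change (∫ x in (0:ℝ)..1, (H (s, x) * charIntegral (shear F) s x
      + charIntegral H s x * shear F (s, x))) = charIntegral H s 1 * charIntegral (shear F) s 1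
      at parts
    rw [intervalIntegral.integral_of_le zero_le_one, integral_Ioc_eq_integral_Ioo,
      integral_add i2 i1] at parts
    have e1 : ∫ x in Ioo (0 : ℝ) 1, charSolution T ρ₀ p H N s x * shear F (s, x) =
        inflow T ρ₀ p H N s * charIntegral (shear F) s 1 +
          ∫ x in Ioo (0 : ℝ) 1, charIntegral H s x * shear F (s, x) := by
      simp only [charSolution, add_mul]
      rw [integral_add (i3.const_mul _) i1, integral_const_mul,
        charIntegral_of_mem (H := shear F) zero_le_one]
    have e2 : ∫ x in Ioo (0 : ℝ) 1, H (s, x) * backwardTest F N (s + x) x =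
        charIntegral H s 1 * (charIntegral (shear F) s 1 + returnSum F N (s + 1)) -
          ∫ x in Ioo (0 : ℝ) 1, H (s, x) * charIntegral (shear F) s x := by
      rw [charIntegral_of_mem (H := H) zero_le_one, ← integral_mul_const,
        ← integral_sub (iH.mul_const _) i2]
      refine setIntegral_congr_fun measurableSet_Ioo fun x hx => ?_
      rw [backwardTest_char h0 hF N (Ioo_subset_Icc_self hx)]
      ring
    rw [e1, e2]
    linarith
  have total : (∫ z, charSolution T ρ₀ p H N z.1 z.2 * shear F z ∂stripMeasure) -
      (∫ z, H z * backwardTest F N (z.1 + z.2) z.2 ∂stripMeasure) =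
      (∫ s, inflow T ρ₀ p H N s * charIntegral (shear F) s 1) -
        ∫ s, charIntegral H s 1 * returnSum F N (s + 1) := by
    rw [integral_prod _ iW, integral_prod _ iσ,
      ← integral_sub iW.integral_prod_left iσ.integral_prod_left,
      ← integral_sub (integrable_mul_two (memLp_inflow h hρ hp N) hS.memLp_total)
        (integrable_mul_two h.memLp_total LP1)]
    exact integral_congr_ae slice
  rw [integral_inflow_mul h hS hρ hp] at total
  linarith

end Duality

/-- A weak solution of the periodic transport equation is given by its characteristics. -/
lemma ae_eq_charSolution {T : ℝ} {N : ℕ} (hT : 0 < T) (hN : T ≤ N) {ρ d : ℝ → ℝ → ℝ}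
    {ρ₀ p : ℝ → ℝ} {h : ℝ × ℝ → ℝ} (hρ : MemL2Q T ρ) (hd : MemL2Q T d) (hρ₀ : MemL2Space ρ₀)
    (hp : MemL2Time T p) (hs : IsCharSource T (shear h))
    (hoff : ∀ z : ℝ × ℝ, z.1 ∉ Ioo 0 T → h z = 0)
    (hhd : ∀ᵐ z ∂(cylMeasure T), h z = -d z.1 z.2)
    (weak : ∀ σ σt σx : ℝ → ℝ → ℝ, IsTransportTest T σ σt σx →
      ∫ z, ρ z.1 z.2 * (σt z.1 z.2 + σx z.1 z.2) ∂(cylMeasure T) =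
        (∫ z, d z.1 z.2 * σ z.1 z.2 ∂(cylMeasure T)) -
        (∫ x in (0 : ℝ)..1, ρ₀ x * σ 0 x) - ∫ t in (0 : ℝ)..T, σ t 1 * p t) :
    ∀ᵐ z ∂(cylMeasure T), ρ z.1 z.2 = charSolution T ρ₀ p (shear h) N (z.1 - z.2) z.2 := by
  have Lρ := memL2Q_iff.mp hρ
  have LW : MemLp (fun z : ℝ × ℝ => charSolution T ρ₀ p (shear h) N (z.1 - z.2) z.2) 2
      (cylMeasure T) := by
    have m : MeasurePreserving (fun z : ℝ × ℝ => (z.1 - z.2, z.2)) stripMeasure stripMeasure :=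
      measurePreserving_sub_prod _ _
    rw [cylMeasure_eq_restrict]
    exact ((memLp_charSolution hs hρ₀ hp N).comp_measurePreserving m).restrict _
  have iρ : Integrable (fun z : ℝ × ℝ => ρ z.1 z.2) (cylMeasure T) := Lρ.integrable (by norm_num)
  have iW := LW.integrable (q := 2) (by norm_num)
  have key : ∀ᵐ z : ℝ × ℝ, z ∈ Ioo (0 : ℝ) T ×ˢ Ioo (0 : ℝ) 1 →
      ρ z.1 z.2 - charSolution T ρ₀ p (shear h) N (z.1 - z.2) z.2 = 0 := by
    refine (isOpen_Ioo.prod isOpen_Ioo).ae_eq_zero_of_integral_contDiff_smul_eq_zero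
      (IntegrableOn.locallyIntegrableOn ?_) fun F hF hc hsupp => ?_
    · rw [IntegrableOn, volume_restrict_cyl]
      exact iρ.sub iW
    have h0 : ∀ z, z ∉ Ioo 0 T ×ˢ Ioo (0 : ℝ) 1 → F z = 0 := fun z hz =>
      image_eq_zero_of_notMem_tsupport fun hm => hz (hsupp hm)
    have cF := hF.continuous
    -- The test function with `σₜ + σₓ = -F` turns the weak equation into a formula for `∫ ρ F`;
    -- `dual` below gives the same formula for the candidate.
    obtain ⟨σt, σx, hσ, eqn⟩ := exists_isTransportTest (hF.of_le (by exact_mod_cast le_top)) hc h0 hN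
    have w := weak _ _ _ hσ
    have LF : MemLp F 2 (cylMeasure T) := memL2Q_iff.mp (memL2Q_of_continuous (T := T)
      (w := fun t x => F (t, x)) (by simpa [Function.uncurry_def] using cF))
    have Lσ : MemLp (fun z : ℝ × ℝ => backwardTest F N z.1 z.2) 2 (cylMeasure T) :=
      memL2Q_iff.mp (memL2Q_of_continuous hσ.cont)
    have w1 : ∫ z, ρ z.1 z.2 * (σt z.1 z.2 + σx z.1 z.2) ∂(cylMeasure T) =
        -∫ z, ρ z.1 z.2 * F z ∂(cylMeasure T) := by
      rw [← integral_neg]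
      refine integral_congr_ae ?_
      filter_upwards [ae_cyl_mem T] with z hz
      rw [eqn z.1 z.2 hz.2]; ring
    have w2 : ∫ x in (0 : ℝ)..1, ρ₀ x * backwardTest F N 0 x =
        ∫ x in Ioo (0 : ℝ) 1, ρ₀ x * returnSum F N (-x) := by
      rw [intervalIntegral.integral_of_le zero_le_one, integral_Ioc_eq_integral_Ioo]
      refine setIntegral_congr_fun measurableSet_Ioo fun x hx => ?_
      rw [backwardTest_initial h0 (isCharSource_shear cF hc h0) hN (Ioo_subset_Icc_self hx)]
    have w3 : ∫ t in (0 : ℝ)..T, backwardTest F N t 1 * p t =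
        ∫ t in Ioo (0 : ℝ) T, p t * returnSum F N t := by
      rw [intervalIntegral.integral_of_le hT.le, integral_Ioc_eq_integral_Ioo]
      congr 1; ext t
      rw [backwardTest_one h0 cF, mul_comm]
    set G : ℝ × ℝ → ℝ := fun z => h z * backwardTest F N z.1 z.2 with hG
    have eG : (fun z : ℝ × ℝ => shear h z * backwardTest F N (z.1 + z.2) z.2) = shear G := rfl
    have iG : Integrable (shear G) stripMeasure := by
      have m : MeasurePreserving (fun z : ℝ × ℝ => (z.1 + z.2, z.2)) stripMeasure stripMeasure :=
        measurePreserving_add_prod _ _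
      have i1 : Integrable G (cylMeasure T) := by
        refine (integrable_mul_two (memL2Q_iff.mp hd).neg Lσ).congr ?_
        filter_upwards [hhd] with z hz
        rw [hG]; simp only [hz]; rfl
      have i2 : Integrable G stripMeasure := by
        rw [cylMeasure_eq_restrict] at i1
        refine (integrableOn_iff_integrable_of_support_subset ?_).mp i1
        intro z hz
        by_contra hn
        exact hz (by rw [hG]; simp only; rw [hoff z fun hm => hn ⟨hm, mem_univ _⟩, zero_mul])
      exact (m.integrable_comp i2.1).mpr i2
    have dual := integral_charSolution_mul hs cF hc h0 hρ₀ hp N (by rw [eG]; exact iG)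
    rw [eG, integral_strip_shear (T := T) (fun z hz => by
      rw [hG]; simp only; rw [hoff z hz, zero_mul])] at dual
    have w4 : ∫ z, G z ∂(cylMeasure T) =
        -∫ z, d z.1 z.2 * backwardTest F N z.1 z.2 ∂(cylMeasure T) := by
      rw [← integral_neg]
      refine integral_congr_ae ?_
      filter_upwards [hhd] with z hz
      rw [hG]; simp only [hz]; ring
    have w5 : ∫ z, charSolution T ρ₀ p (shear h) N z.1 z.2 * shear F z ∂stripMeasure =
        ∫ z, charSolution T ρ₀ p (shear h) N (z.1 - z.2) z.2 * F z ∂(cylMeasure T) := by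
      rw [← integral_strip_shear fun z hz => by rw [h0 z fun hm => hz hm.1, mul_zero]]
      simp only [shear, add_sub_cancel_right]
    rw [w1, w2, w3] at w
    rw [w4, w5] at dual
    rw [← setIntegral_eq_integral_of_forall_compl_eq_zero (s := Ioo (0 : ℝ) T ×ˢ Ioo (0 : ℝ) 1)
      (fun z hz => by rw [h0 z hz, zero_smul]), volume_restrict_cyl]
    simp only [smul_eq_mul, mul_sub]
    simp_rw [mul_comm (F _)]
    have iρF : Integrable (fun z : ℝ × ℝ => ρ z.1 z.2 * F z) (cylMeasure T) :=
      integrable_mul_two Lρ LF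
    rw [integral_sub iρF (integrable_mul_two LW LF)]
    linarith
  rw [← volume_restrict_cyl, ae_restrict_iff' (measurableSet_Ioo.prod measurableSet_Ioo)]
  filter_upwards [key] with z hz hm
  exact sub_eq_zero.mp (hz hm)

/-! ### The trace and the energy inequality along characteristics. -/

/-- Translations are continuous in `L²(ℝ)`. -/
lemma tendsto_integral_sq_translate_sub {θ : ℝ → ℝ} (hθ : MemLp θ 2 volume) :
    Tendsto (fun y => ∫ t, (θ (t + y) - θ t) ^ 2) (𝓝 0) (𝓝 0) := by
  set g : ℝ → C(ℝ, ℝ) := fun y => ⟨fun t => t + y, by fun_prop⟩ with hg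
  have mp : ∀ y : ℝ, MeasurePreserving (g y) volume volume :=
    fun y => measurePreserving_add_right volume y
  have cg : Continuous g := ContinuousMap.continuous_of_continuous_uncurry _
    (by simp only [hg, Function.uncurry_def, ContinuousMap.coe_mk]; fun_prop)
  have c : Continuous fun y => Lp.compMeasurePreserving (g y) (mp y) (hθ.toLp θ) :=
    Continuous.compMeasurePreservingLp continuous_const cg mp (by norm_num)
  have c2 : Continuous fun y =>
      ‖Lp.compMeasurePreserving (g y) (mp y) (hθ.toLp θ) - hθ.toLp θ‖ ^ 2 :=
    (c.sub continuous_const).norm.pow 2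
  have e : ∀ y, ‖Lp.compMeasurePreserving (g y) (mp y) (hθ.toLp θ) - hθ.toLp θ‖ ^ 2 =
      ∫ t, (θ (t + y) - θ t) ^ 2 := fun y => by
    rw [Lp.toLp_compMeasurePreserving hθ (mp y), ← MemLp.toLp_sub, norm_toLp_sq]
    rfl
  simp_rw [e] at c2
  simpa using c2.tendsto 0

section Trace

variable {T : ℝ} {H : ℝ × ℝ → ℝ} {ρ₀ p : ℝ → ℝ}

lemma sq_charIntegral_sub_le {s x : ℝ} (hx : x ∈ Ioo (0 : ℝ) 1)
    (h : MemLp (fun x => H (s, x)) 2 (volume.restrict (Ioo (0 : ℝ) 1))) :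
    (charIntegral H s 1 - charIntegral H s x) ^ 2 ≤
      (1 - x) * ∫ y in Ioo (0 : ℝ) 1, H (s, y) ^ 2 := by
  have ii : IntervalIntegrable (fun x => H (s, x)) volume 0 1 :=
    (intervalIntegrable_iff_integrableOn_Ioo_of_le zero_le_one).mpr (h.integrable (by norm_num))
  have i1 : IntervalIntegrable (fun x => H (s, x)) volume 0 x :=
    ii.mono_set (by rw [uIcc_of_le hx.1.le, uIcc_of_le zero_le_one]; exact Icc_subset_Icc_right hx.2.le)
  have sub : Ioo x 1 ⊆ Ioo (0:ℝ) 1 := Ioo_subset_Ioo_left hx.1.le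
  have h' : MemLp (fun x => H (s, x)) 2 (volume.restrict (Ioo x 1)) :=
    h.mono_measure (Measure.restrict_mono_set _ sub)
  rw [charIntegral, charIntegral, intervalIntegral.integral_interval_sub_left ii i1,
    intervalIntegral.integral_of_le hx.2.le, integral_Ioc_eq_integral_Ioo]
  refine (sq_integral_le h').trans ?_
  have e : (volume.restrict (Ioo x 1)).real univ = 1 - x := by
    simp [measureReal_restrict_apply, hx.2.le]
  rw [e]
  exact mul_le_mul_of_nonneg_left (setIntegral_mono_set h.integrable_sq
    (ae_of_all _ fun _ => sq_nonneg _) sub.eventuallyLE) (by linarith [hx.2])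

/-- For almost every `x`, `ρ(t,x)` is `θ(t + 1 - x)` minus the source integrated from `x` to `1`.
The first tends to `θ` by continuity of translations; the second has squared norm `O(1 - x)` by
Cauchy–Schwarz. -/
lemma hasTraceAtOne_outflow (hT : 0 < T) (h : IsCharSource T H) (hρ₀ : MemL2Space ρ₀)
    (hp : MemL2Time T p) {N : ℕ} {ρ : ℝ → ℝ → ℝ} (hρ : MemL2Q T ρ)
    (rep : ∀ᵐ z ∂(cylMeasure T), ρ z.1 z.2 = charSolution T ρ₀ p H N (z.1 - z.2) z.2) :
    HasTraceAtOne T ρ (outflow T ρ₀ p H N) := by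
  set θ := outflow T ρ₀ p H N with hθ
  have Lθ : MemLp θ 2 volume := memLp_outflow h hρ₀ hp N
  set M : ℝ → ℝ := fun s => ∫ y in Ioo (0 : ℝ) 1, H (s, y) ^ 2 with hM
  have iM : Integrable M := h.memLp.integrable_sq.integral_prod_left
  have M0 : ∀ s, 0 ≤ M s := fun s => integral_nonneg fun _ => sq_nonneg _
  refine hasTraceAtOne_of_modulus hT.le hρ (Lθ.restrict _)
    (ω := fun y => 2 * (∫ t, (θ (t + y) - θ t) ^ 2) + 2 * y * ∫ s, M s) ?_ ?_
  · refine Tendsto.mono_left ?_ nhdsWithin_le_nhds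
    have h1 := (tendsto_integral_sq_translate_sub Lθ).const_mul 2
    have h2 : Tendsto (fun y : ℝ => 2 * y * ∫ s, M s) (𝓝 0) (𝓝 0) := by
      have : Continuous fun y : ℝ => 2 * y * ∫ s, M s := by fun_prop
      simpa using this.tendsto 0
    simpa using h1.add h2
  have rep' : ∀ᵐ x ∂(volume.restrict (Ioo (0 : ℝ) 1)), ∀ᵐ t ∂(volume.restrict (Ioo (0 : ℝ) T)),
      ρ t x = charSolution T ρ₀ p H N (t - x) x :=
    Measure.ae_ae_of_ae_prod (Measure.measurePreserving_swap.quasiMeasurePreserving.ae rep)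
  rw [ae_restrict_iff' measurableSet_Ioo] at rep'
  filter_upwards [rep'] with x hx hx1
  have Lsh : MemLp (fun t => θ (t + (1 - x))) 2 volume :=
    Lθ.comp_measurePreserving (measurePreserving_add_right volume (1 - x))
  have i1 : Integrable fun t => (θ (t + (1 - x)) - θ t) ^ 2 := (Lsh.sub Lθ).integrable_sq
  have i2 : Integrable fun t => M (t - x) := iM.comp_sub_right x
  have i3 : Integrable fun t => 2 * (θ (t + (1 - x)) - θ t) ^ 2 + 2 * (1 - x) * M (t - x) :=
    (i1.const_mul 2).add (i2.const_mul (2 * (1 - x)))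
  have slice : ∀ᵐ t : ℝ, MemLp (fun y => H (t - x, y)) 2 (volume.restrict (Ioo (0 : ℝ) 1)) :=
    (measurePreserving_sub_right volume x).quasiMeasurePreserving.ae h.ae_slice
  rw [intervalIntegral.integral_of_le hT.le, integral_Ioc_eq_integral_Ioo]
  calc ∫ t in Ioo (0 : ℝ) T, (ρ t x - θ t) ^ 2
      ≤ ∫ t in Ioo (0 : ℝ) T, (2 * (θ (t + (1 - x)) - θ t) ^ 2 + 2 * (1 - x) * M (t - x)) := by
        refine integral_mono_of_nonneg (ae_of_all _ fun _ => sq_nonneg _) i3.restrict ?_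
        filter_upwards [hx hx1, ae_restrict_of_ae slice] with t h1 h2
        have b := sq_charIntegral_sub_le hx1 h2
        have e1 : θ (t + (1 - x)) =
            inflow T ρ₀ p H N (t - x) + charIntegral H (t - x) 1 := by
          rw [hθ, outflow]; congr 2 <;> ring
        have e2 : ρ t x - θ t = (θ (t + (1 - x)) - θ t) -
            (charIntegral H (t - x) 1 - charIntegral H (t - x) x) := by
          rw [h1, e1, charSolution]; ring
        rw [e2]
        set a := θ (t + (1 - x)) - θ t
        set c := charIntegral H (t - x) 1 - charIntegral H (t - x) x
        change c ^ 2 ≤ (1 - x) * M (t - x) at b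
        nlinarith [sq_nonneg (a + c)]
    _ ≤ ∫ t, (2 * (θ (t + (1 - x)) - θ t) ^ 2 + 2 * (1 - x) * M (t - x)) := by
        refine setIntegral_le_integral i3 (ae_of_all _ fun t => ?_)
        have := M0 (t - x)
        have h1 : 0 ≤ 1 - x := by linarith [hx1.2]
        simp only [Pi.zero_apply]
        positivity
    _ = _ := by
        rw [integral_add (i1.const_mul 2) (i2.const_mul (2 * (1 - x))), integral_const_mul,
          integral_const_mul, integral_sub_right_eq_self M x]

/-- Energy inequality for the transport equation, with `x` as evolution variable. -/
lemma neg_le_integral_charSolution_mul_source (hT : 0 < T) (h : IsCharSource T H)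
    (hρ₀ : MemL2Space ρ₀) (hp : MemL2Time T p) {N : ℕ} (hN : T ≤ N) :
    -((∫ x in Ioo (0 : ℝ) 1, ρ₀ x ^ 2) / 2 + (∫ t in Ioo (0 : ℝ) T, outflow T ρ₀ p H N t * p t) +
      (∫ t in Ioo (0 : ℝ) T, p t ^ 2) / 2) ≤
      ∫ z, charSolution T ρ₀ p H N z.1 z.2 * H z ∂stripMeasure := by
  set θ := outflow T ρ₀ p H N with hθ
  set q := inflow T ρ₀ p H N with hq
  have Lθ : MemLp θ 2 volume := memLp_outflow h hρ₀ hp N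
  have Lq : MemLp q 2 volume := memLp_inflow h hρ₀ hp N
  have Lsh : MemLp (fun t => θ (t + 1)) 2 volume :=
    Lθ.comp_measurePreserving (measurePreserving_add_right volume 1)
  -- On a characteristic the source is the derivative of the solution, so the integral is half the
  -- difference of the squares at `x = 1` and `x = 0`.
  have slice : ∀ᵐ s : ℝ, ∫ x in Ioo (0 : ℝ) 1, charSolution T ρ₀ p H N s x * H (s, x) =
      (Ioo (-1 : ℝ) T).indicator (fun s => (1 / 2) * (θ (s + 1) ^ 2 - q s ^ 2)) s := by
    filter_upwards [h.ae_slice] with s hs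
    have iH' : IntervalIntegrable (fun x => H (s, x)) volume 0 1 :=
      (intervalIntegrable_iff_integrableOn_Ioo_of_le zero_le_one).mpr
        (hs.integrable (by norm_num))
    by_cases hm : s ∈ Ioo (-1 : ℝ) T
    · have := integral_primitive_mul_self (c := q s) iH'
      rw [intervalIntegral.integral_of_le zero_le_one, integral_Ioc_eq_integral_Ioo] at this
      rw [indicator_of_mem hm]
      refine this.trans ?_
      have e : θ (s + 1) = q s + ∫ y in (0:ℝ)..1, H (s, y) := by
        rw [hθ, outflow, add_sub_cancel_right, charIntegral]
      rw [e]; ring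
    · rw [indicator_of_notMem hm]
      refine setIntegral_eq_zero_of_forall_eq_zero fun x hx => ?_
      rw [h.supp s x hx fun hc => hm ⟨by linarith [hc.1, hx.2], by linarith [hc.2, hx.1]⟩, mul_zero]
  have I1 : ∫ z, charSolution T ρ₀ p H N z.1 z.2 * H z ∂stripMeasure =
      (1 / 2) * ((∫ s in Ioo (-1 : ℝ) T, θ (s + 1) ^ 2) - ∫ s in Ioo (-1 : ℝ) T, q s ^ 2) := by
    rw [integral_prod _ (integrable_mul_two (memLp_charSolution h hρ₀ hp N) h.memLp),
      integral_congr_ae slice, integral_indicator measurableSet_Ioo, integral_const_mul,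
      integral_sub Lsh.integrable_sq.restrict Lq.integrable_sq.restrict]
  -- The discarded part, over `(T, T+1)`, is the energy of the state at time `T`.
  have I2 : ∫ t in Ioo (0 : ℝ) T, θ t ^ 2 ≤ ∫ s in Ioo (-1 : ℝ) T, θ (s + 1) ^ 2 := by
    have e : ∫ s in Ioo (-1 : ℝ) T, θ (s + 1) ^ 2 = ∫ t in Ioo (0 : ℝ) (T + 1), θ t ^ 2 := by
      rw [← integral_Ioc_eq_integral_Ioo, ← integral_Ioc_eq_integral_Ioo,
        ← intervalIntegral.integral_of_le (by linarith),
        ← intervalIntegral.integral_of_le (by linarith),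
        intervalIntegral.integral_comp_add_right (fun t => θ t ^ 2)]
      norm_num
    rw [e]
    exact setIntegral_mono_set Lθ.integrable_sq.restrict (ae_of_all _ fun _ => sq_nonneg _)
      (Ioo_subset_Ioo_right (by linarith)).eventuallyLE
  have Lp' : MemLp p 2 (volume.restrict (Ioo (0:ℝ) T)) := hp
  have Lθ' : MemLp θ 2 (volume.restrict (Ioo (0:ℝ) T)) := Lθ.restrict _
  -- The inflow is `ρ₀(-s)` on `(-1,0)` and `θ + p` on `(0,T)`; its `∫ θ²` cancels that of `I2`.
  have I3 : ∫ s in Ioo (-1 : ℝ) T, q s ^ 2 = (∫ x in Ioo (0 : ℝ) 1, ρ₀ x ^ 2) +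
      ((∫ t in Ioo (0 : ℝ) T, θ t ^ 2) + 2 * (∫ t in Ioo (0 : ℝ) T, θ t * p t) +
        ∫ t in Ioo (0 : ℝ) T, p t ^ 2) := by
    have e0 : ∫ s in Ioo (-1 : ℝ) T, q s ^ 2 =
        (∫ s in Ioo (-1 : ℝ) 0, q s ^ 2) + ∫ s in Ioo (0 : ℝ) T, q s ^ 2 := by
      simp only [← integral_Ioc_eq_integral_Ioo]
      rw [← intervalIntegral.integral_of_le (by linarith),
        ← intervalIntegral.integral_of_le (by norm_num), ← intervalIntegral.integral_of_le hT.le,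
        intervalIntegral.integral_add_adjacent_intervals
          Lq.integrable_sq.intervalIntegrable Lq.integrable_sq.intervalIntegrable]
    have e1 : ∫ s in Ioo (-1 : ℝ) 0, q s ^ 2 = ∫ x in Ioo (0 : ℝ) 1, ρ₀ x ^ 2 := by
      rw [← (memLp_comp_neg hρ₀).2, ← integral_indicator measurableSet_Ioo]
      congr 1; ext s
      by_cases hs : s ∈ Ioo (-1 : ℝ) 0
      · rw [indicator_of_mem hs, indicator_of_mem hs, hq, inflow_eq_initial h hs]
      · rw [indicator_of_notMem hs, indicator_of_notMem hs]; norm_num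
    have e2 : ∫ s in Ioo (0 : ℝ) T, q s ^ 2 =
        ∫ t in Ioo (0 : ℝ) T, (θ t ^ 2 + 2 * (θ t * p t) + p t ^ 2) := by
      refine setIntegral_congr_fun measurableSet_Ioo fun s hs => ?_
      simp only [hq, inflow_eq_outflow h hN hs]
      ring
    have i12 : Integrable (fun t => θ t ^ 2 + 2 * (θ t * p t)) (volume.restrict (Ioo (0:ℝ) T)) :=
      Lθ'.integrable_sq.add ((integrable_mul_two Lθ' Lp').const_mul 2)
    rw [e0, e1, e2, integral_add i12 Lp'.integrable_sq, integral_add Lθ'.integrable_sq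
      ((integrable_mul_two Lθ' Lp').const_mul 2), integral_const_mul]
  rw [I1, I3]
  linarith

end Trace

/-! ### Closing the estimate. -/

theorem lemmaD1 (T : ℝ) (hT : 0 < T) :
    ∃ C : ℝ, 0 < C ∧
      ∀ ρ₀ u₀ p : ℝ → ℝ, MemL2Space ρ₀ → MemL2Space u₀ → MemDotL2Time T p →
        ∀ ρ u : ℝ → ℝ → ℝ, IsTranspositionSolution T ρ₀ u₀ p ρ u →
          ∃ θ : ℝ → ℝ, MemL2Time T θ ∧ HasTraceAtOne T ρ θ ∧
            ∫ t in (0 : ℝ)..T, θ t ^ 2 ≤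
              C * ((∫ x in (0 : ℝ)..1, ρ₀ x ^ 2) + (∫ x in (0 : ℝ)..1, u₀ x ^ 2)
                + ∫ t in (0 : ℝ)..T, p t ^ 2) := by
  set N := ⌈T⌉₊ with hNdef
  have hN : T ≤ N := Nat.le_ceil T
  set c : ℝ := 8 * ((N : ℝ) + 1) ^ 2 with hc
  have c0 : 0 < c := by positivity
  refine ⟨c * (3 + c), by positivity, ?_⟩
  intro ρ₀ u₀ p hρ₀ hu₀ hp ρ u hs
  obtain ⟨d, hd, hder, hheat⟩ := hs.exists_weak_derivative hT hu₀
  obtain ⟨h, hsrc, hoff, hhd⟩ := hd.exists_source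
  have weak : ∀ σ σt σx : ℝ → ℝ → ℝ, IsTransportTest T σ σt σx →
      ∫ z, ρ z.1 z.2 * (σt z.1 z.2 + σx z.1 z.2) ∂(cylMeasure T) =
        (∫ z, d z.1 z.2 * σ z.1 z.2 ∂(cylMeasure T)) -
        (∫ x in (0 : ℝ)..1, ρ₀ x * σ 0 x) - ∫ t in (0 : ℝ)..T, σ t 1 * p t := by
    intro σ σt σx hσ
    have h1 := hs.transport_weak hT.le hσ
    rw [hder σ σx hσ.cont hσ.cont_x hσ.deriv_x] at h1
    linarith
  have rep := ae_eq_charSolution hT hN hs.memL2Q_fst hd hρ₀ hp.1 hsrc hoff hhd weak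
  have tr := hasTraceAtOne_outflow hT hsrc hρ₀ hp.1 hs.memL2Q_fst rep
  refine ⟨_, tr.memL2Time, tr, ?_⟩
  have bound := integral_sq_outflow_le hsrc hρ₀ hp.1 N
  have energy := neg_le_integral_charSolution_mul_source hT hsrc hρ₀ hp.1 hN
  set θ := outflow T ρ₀ p (shear h) N
  have Lθ : MemLp θ 2 volume := memLp_outflow hsrc hρ₀ hp.1 N
  have Lθ' : MemLp θ 2 (volume.restrict (Ioo (0:ℝ) T)) := Lθ.restrict _
  have Lp' : MemLp p 2 (volume.restrict (Ioo (0:ℝ) T)) := hp.1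
  have eX : ∫ z, shear h z ^ 2 ∂stripMeasure = ∫ z, d z.1 z.2 ^ 2 ∂(cylMeasure T) := by
    have := integral_strip_shear (T := T) (G := fun z => h z ^ 2) fun z hz => by
      rw [hoff z hz]; norm_num
    refine this.trans (integral_congr_ae ?_)
    filter_upwards [hhd] with z hz
    rw [hz, neg_sq]
  have eE : ∫ z, charSolution T ρ₀ p (shear h) N z.1 z.2 * shear h z ∂stripMeasure =
      -∫ z, d z.1 z.2 * ρ z.1 z.2 ∂(cylMeasure T) := by
    have := integral_strip_shear (T := T)
      (G := fun z => charSolution T ρ₀ p (shear h) N (z.1 - z.2) z.2 * h z) fun z hz => by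
      rw [hoff z hz, mul_zero]
    rw [← integral_neg]
    refine Eq.trans ?_ (this.trans (integral_congr_ae ?_))
    · simp only [shear, add_sub_cancel_right]
    · filter_upwards [hhd, rep] with z h1 h2
      rw [h1, ← h2]; ring
  -- With weight `1/(2c)`, the bound `Θ ≤ c (A + P + X)` contributes only `X/2`, which the left side
  -- absorbs.
  have young : ∫ t in Ioo (0 : ℝ) T, θ t * p t ≤
      (1 / (2 * c)) * (∫ t in Ioo (0 : ℝ) T, θ t ^ 2) + (c / 2) * ∫ t in Ioo (0 : ℝ) T, p t ^ 2 := by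
    rw [← integral_const_mul, ← integral_const_mul,
      ← integral_add (Lθ'.integrable_sq.const_mul _) (Lp'.integrable_sq.const_mul _)]
    refine integral_mono (integrable_mul_two Lθ' Lp')
      ((Lθ'.integrable_sq.const_mul _).add (Lp'.integrable_sq.const_mul _)) fun t => ?_
    have e : 1 / (2 * c) * θ t ^ 2 + c / 2 * p t ^ 2 - θ t * p t =
        (1 / (2 * c)) * (θ t - c * p t) ^ 2 := by field_simp; ring
    have : 0 ≤ (1 / (2 * c)) * (θ t - c * p t) ^ 2 := by positivity
    simp only
    linarith
  have mono : ∫ t in Ioo (0 : ℝ) T, θ t ^ 2 ≤ ∫ t, θ t ^ 2 :=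
    setIntegral_le_integral Lθ.integrable_sq (ae_of_all _ fun _ => sq_nonneg _)
  simp only [intervalIntegral.integral_of_le hT.le, intervalIntegral.integral_of_le zero_le_one,
    integral_Ioc_eq_integral_Ioo] at hheat ⊢
  rw [eX] at bound
  rw [eE] at energy
  have nA : 0 ≤ ∫ x in Ioo (0 : ℝ) 1, ρ₀ x ^ 2 := integral_nonneg fun _ => sq_nonneg _
  have nB : 0 ≤ ∫ x in Ioo (0 : ℝ) 1, u₀ x ^ 2 := integral_nonneg fun _ => sq_nonneg _
  have nP : 0 ≤ ∫ t in Ioo (0 : ℝ) T, p t ^ 2 := integral_nonneg fun _ => sq_nonneg _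
  set A := ∫ x in Ioo (0 : ℝ) 1, ρ₀ x ^ 2
  set B := ∫ x in Ioo (0 : ℝ) 1, u₀ x ^ 2
  set P := ∫ t in Ioo (0 : ℝ) T, p t ^ 2
  set X := ∫ z, d z.1 z.2 ^ 2 ∂(cylMeasure T)
  set Θ := ∫ t in Ioo (0 : ℝ) T, θ t ^ 2
  have hΘ : Θ ≤ c * (A + P + X) := mono.trans bound
  have hΘ' : 1 / (2 * c) * Θ ≤ (A + P + X) / 2 := by
    calc 1 / (2 * c) * Θ ≤ 1 / (2 * c) * (c * (A + P + X)) := by gcongr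
      _ = (A + P + X) / 2 := by field_simp
  -- The inequalities combine to `X ≤ (A + B + P)/2 + (A + P + X)/2 + c P/2`.
  have hX : X ≤ (2 + c) * (A + B + P) := by nlinarith
  calc Θ ≤ c * (A + P + X) := hΘ
    _ ≤ c * ((A + B + P) + (2 + c) * (A + B + P)) := by gcongr; linarith
    _ = c * (3 + c) * (A + B + P) := by ring
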